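/- For every $n\ge 1$ let $\mathcal H_{A,n},\mathcal H_{B,n}$ be complex (finite- or infinite-dimensional separable) Hilbert spaces, let $\Phi_n\in\mathcal H_{A,n}\otimes\mathcal H_{B,n}$ be a unit vector, and let $\rho_n=\mathrm{Tr}_B|\Phi_n\rangle\langle\Phi_n|$. No relation between different $n$ is assumed. *Definitions.* A maximally entangled state of size $L\in\{1,2,\dots\}$ is a vector $\Psi=L^{-1/2}\sum_{k=1}^L e_k\otimes f_k$ with orthonormal systems $(e_k)$ and $(f_k)$. LOCC operations consist of finitely many rounds, in each of which one party measures its own system and announces the outcome; the output spaces are arbitrary. A deterministic concentration (DFLEC) is a pair $(C,\Psi)$ of an LOCC operation $C$ and a maximally entangled state $\Psi$ on its output space; its size $L(\Psi)$ is that of $\Psi$, and its fidelity is $\langle\Psi|C(\Phi)|\Psi\rangle$, where $C(\Phi)=C(|\Phi\rangle\langle\Phi|)$. A probabilistic concentration (PFLEC) of $\Phi$ is a two-valued LOCC instrument $I=\{I_0,I_1\}$ together with a maximally entangled state $\Psi$ such that $I_1(\Phi)=\mathrm{Tr}\,I_1(\Phi)\,|\Psi\rangle\langle\Psi|$ (no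 condition on $\Psi$ if $\mathrm{Tr}\,I_1(\Phi)=0$); its size $L(I)$ is that of $\Psi$. All limits are for $n\to\infty$, $\log 0=-\infty$, and suprema are taken in $[-\infty,\infty]$ with $\sup\emptyset=-\infty$. Put $$B_D(\epsilon)=\sup\{\varliminf\tfrac1n\log L(\Psi_n): \varliminf\langle\Psi_n|C^n(\Phi_n)|\Psi_n\rangle\ge1-\epsilon\},$$ $$B_{e,D}(r)=\sup\{\varliminf\tfrac1n\log L(\Psi_n): \varliminf\tfrac{-1}n\log(1-\langle\Psi_n|C^n(\Phi_n)|\Psi_n\rangle)\ge r\},$$ $$B^*_{e,D}(r)=\sup\{\varliminf\tfrac1n\log L(\Psi_n): \varlimsup\tfrac{-1}n\log\langle\Psi_n|C^n(\Phi_n)|\Psi_n\rangle\le r\},$$ the suprema being over all sequences of DFLECs $(C^n,\Psi_n)$, and $$B_P(\epsilon)=\sup\{\varliminf\tfrac1n\log L(I^n): \varlimsup\mathrm{Tr}\,I^n_0(\Phi_n)\le\epsilon\},$$ $$B_{e,P}(r)=\sup\{\varliminf\tfrac1n\log L(I^n): \varliminf\tfrac{-1}n\log\mathrm{Tr}\,I^n_0(\Phi_n)\ge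 r\},$$ $$B^*_{e,P}(r)=\sup\{\varliminf\tfrac1n\log L(I^n): \varlimsup\tfrac{-1}n\log\mathrm{Tr}\,I^n_1(\Phi_n)\le r\},$$ the suprema being over all sequences of PFLECs $I^n$ of $\Phi_n$. For real $a$ let $$K(a)=\varlimsup\mathrm{Tr}\,\rho_n\{\rho_n\ge e^{-na}\},\qquad \underline\zeta^c(a)=\varliminf\tfrac{-1}n\log\mathrm{Tr}\,\rho_n\{\rho_n>e^{-na}\},$$ where $\{\cdot\}$ denotes spectral projections, and, if it exists in $[0,\infty]$, let $\zeta(a)=\lim\tfrac{-1}n\log\mathrm{Tr}\,\rho_n\{\rho_n<e^{-na}\}$. **Theorem.** (i) For every $\epsilon\in[0,1]$ and every real $r$, $$B_D(\epsilon)=B_P(\epsilon)=\sup\{R\in\mathbb R: K(R)\le\epsilon\},\qquad B_{e,D}(r)=B_{e,P}(r)=\sup\{R\in\mathbb R:\underline\zeta^c(R)\ge r\}.$$ (ii) Assume that the limit $\zeta(a)$ exists in $[0,\infty]$ for every real $a$ and that $\zeta(a)\le\underline\zeta^c(a)$ for some real $a$. Then, with $H(a)=\inf_{a'\le a}\{\zeta(a')-\tfrac{a'}2\}$,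 for every real $r$, $$B^*_{e,D}(r)=\sup\{a-r: a\in\mathbb R,\ H(a)+\tfrac a2\le r\}=\sup\{\tfrac a2-H(a): a\in\mathbb R,\ H(a)+\tfrac a2\le r\},$$ $$B^*_{e,P}(r)=\sup\{a-\zeta(a): a\in\mathbb R,\ \zeta(a)\le r\}.$$ -/

import Mathlib

open Filter Topology
open scoped ENNReal

noncomputable section

namespace EntConc

/-! ### Bipartite systems

A system with (finite or infinite) orthonormal basis indexed by `α` is the Hilbert space
`ℓ²(α, ℂ)`; the composite of the systems `ℓ²(α, ℂ)` and `ℓ²(β, ℂ)` is `ℓ²(α × β, ℂ)`. -/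

/-- The Hilbert space with orthonormal basis indexed by `α`. -/
abbrev Sys (α : Type) : Type := lp (fun _ : α => ℂ) 2

variable {α β α' β' : Type}

theorem summable_sq (x : Sys α) : Summable fun a => ‖x a‖ ^ 2 := by
  simpa using (lp.memℓp x).summable (by norm_num)

theorem norm_sq_eq (x : Sys α) : ‖x‖ ^ 2 = ∑' a, ‖x a‖ ^ 2 := by
  simpa using lp.norm_rpow_eq_tsum (p := 2) (by norm_num) x

theorem memℓp_of_summable_sq {f : α → ℂ} (h : Summable fun a => ‖f a‖ ^ 2) :
    Memℓp f 2 := memℓp_gen (by simpa using h)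

/-- The partial contraction `(1 ⊗ ⟨b|) Φ` of a bipartite vector with a basis vector of the second
system. -/
def sliceB (Φ : Sys (α × β)) (b : β) : Sys α :=
  ⟨fun a => Φ (a, b), memℓp_of_summable_sq
    ((summable_sq Φ).comp_injective (i := fun a : α => (a, b))
      (fun _ _ h => congrArg Prod.fst h))⟩

/-- The partial contraction `(⟨a| ⊗ 1) Φ` of a bipartite vector with a basis vector of the first
system. -/
def sliceA (Φ : Sys (α × β)) (a : α) : Sys β :=
  ⟨fun b => Φ (a, b), memℓp_of_summable_sq
    ((summable_sq Φ).comp_injective (i := fun b : β => (a, b))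
      (fun _ _ h => congrArg Prod.snd h))⟩

theorem summable_sliceB (Φ : Sys (α × β)) : Summable fun b => ‖sliceB Φ b‖ ^ 2 := by
  have h := (Equiv.prodComm β α).summable_iff.mpr (summable_sq Φ)
  have h2 := ((summable_prod_of_nonneg (fun _ => sq_nonneg _)).mp h).2
  refine h2.congr fun b => ?_
  rw [norm_sq_eq]
  rfl

theorem summable_sliceA (Φ : Sys (α × β)) : Summable fun a => ‖sliceA Φ a‖ ^ 2 := by
  have h2 := ((summable_prod_of_nonneg (fun _ => sq_nonneg _)).mp (summable_sq Φ)).2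
  refine h2.congr fun a => ?_
  rw [norm_sq_eq]
  rfl

/-- The vector `(A ⊗ 1) Φ`. -/
def actA (A : Sys α →L[ℂ] Sys α') (Φ : Sys (α × β)) : Sys (α' × β) :=
  ⟨fun p => A (sliceB Φ p.2) p.1, memℓp_of_summable_sq (by
    rw [← (Equiv.prodComm β α').summable_iff]
    refine (summable_prod_of_nonneg (fun _ => sq_nonneg _)).mpr
      ⟨fun b => summable_sq (A (sliceB Φ b)), ?_⟩
    refine Summable.of_nonneg_of_le (fun b => tsum_nonneg fun _ => by positivity) (fun b => ?_)
      ((summable_sliceB Φ).mul_left (‖A‖ ^ 2))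
    change ∑' a, ‖A (sliceB Φ b) a‖ ^ 2 ≤ _
    rw [← norm_sq_eq, ← mul_pow]
    exact pow_le_pow_left₀ (norm_nonneg _) (A.le_opNorm _) 2)⟩

/-- The vector `(1 ⊗ B) Φ`. -/
def actB (B : Sys β →L[ℂ] Sys β') (Φ : Sys (α × β)) : Sys (α × β') :=
  ⟨fun p => B (sliceA Φ p.1) p.2, memℓp_of_summable_sq (by
    refine (summable_prod_of_nonneg (fun _ => sq_nonneg _)).mpr
      ⟨fun a => summable_sq (B (sliceA Φ a)), ?_⟩
    refine Summable.of_nonneg_of_le (fun a => tsum_nonneg fun _ => by positivity) (fun a => ?_)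
      ((summable_sliceA Φ).mul_left (‖B‖ ^ 2))
    change ∑' b, ‖B (sliceA Φ a) b‖ ^ 2 ≤ _
    rw [← norm_sq_eq, ← mul_pow]
    exact pow_le_pow_left₀ (norm_nonneg _) (B.le_opNorm _) 2)⟩

theorem tsum_norm_sq_sliceB (Φ : Sys (α × β)) :
    ∑' b, ENNReal.ofReal (‖sliceB Φ b‖ ^ 2) = ENNReal.ofReal (‖Φ‖ ^ 2) := by
  have key : ∀ {γ : Type} (x : Sys γ),
      ENNReal.ofReal (‖x‖ ^ 2) = ∑' c, ENNReal.ofReal (‖x c‖ ^ 2) := fun x => by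
    rw [norm_sq_eq, ENNReal.ofReal_tsum_of_nonneg (fun _ => sq_nonneg _) (summable_sq x)]
  rw [key Φ, ENNReal.tsum_prod', ENNReal.tsum_comm]
  exact tsum_congr fun b => key _

theorem tsum_norm_sq_sliceA (Φ : Sys (α × β)) :
    ∑' a, ENNReal.ofReal (‖sliceA Φ a‖ ^ 2) = ENNReal.ofReal (‖Φ‖ ^ 2) := by
  have key : ∀ {γ : Type} (x : Sys γ),
      ENNReal.ofReal (‖x‖ ^ 2) = ∑' c, ENNReal.ofReal (‖x c‖ ^ 2) := fun x => by
    rw [norm_sq_eq, ENNReal.ofReal_tsum_of_nonneg (fun _ => sq_nonneg _) (summable_sq x)]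
  rw [key Φ, ENNReal.tsum_prod']
  exact tsum_congr fun b => key _

/-- The operator `|x⟩⟨x|`. -/
def ketbra (x : Sys α) : Sys α →L[ℂ] Sys α := InnerProductSpace.rankOne ℂ x x

/-- The reduced density `Tr_B |Φ⟩⟨Φ| = ∑_b (1 ⊗ ⟨b|) |Φ⟩⟨Φ| (1 ⊗ |b⟩)` on the first system.
The series converges absolutely in operator norm, as the next lemma records. -/
def reduced (Φ : Sys (α × β)) : Sys α →L[ℂ] Sys α := ∑' b, ketbra (sliceB Φ b)

theorem summable_reduced (Φ : Sys (α × β)) : Summable fun b => ketbra (sliceB Φ b) := by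
  refine Summable.of_norm ((summable_sliceB Φ).congr fun b => ?_)
  simp [ketbra, sq]

/-- `Ψ` is a maximally entangled state of size `L`, on a pair of `L`-dimensional subspaces:
`Ψ = L^{-1/2} ∑_{k < L} e_k ⊗ f_k` with orthonormal `e` and `f`. -/
def IsMaxEntangled (Ψ : Sys (α × β)) (L : ℕ) : Prop :=
  0 < L ∧ ∃ (e : Fin L → Sys α) (f : Fin L → Sys β), Orthonormal ℂ e ∧ Orthonormal ℂ f ∧
    ∀ a b, Ψ (a, b) = ((Real.sqrt L)⁻¹ : ℝ) * ∑ k, e k a * f k b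

/-! ### LOCC -/

/-- The Kraus operators of a measurement on one system: `∑_j K_j† K_j = 1`, expressed through the
quadratic forms of both sides. -/
def IsMeasurement {J : Type} (K : J → Sys α →L[ℂ] Sys α') : Prop :=
  ∀ x, HasSum (fun j => ‖K j x‖ ^ 2) (‖x‖ ^ 2)

theorem IsMeasurement.tsum_eq {J : Type} {K : J → Sys α →L[ℂ] Sys α'} (hK : IsMeasurement K)
    (x : Sys α) : ∑' j, ENNReal.ofReal (‖K j x‖ ^ 2) = ENNReal.ofReal (‖x‖ ^ 2) := by
  rw [← (hK x).tsum_eq, ENNReal.ofReal_tsum_of_nonneg (fun _ => sq_nonneg _) (hK x).summable]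

theorem IsMeasurement.tsum_actA {J : Type} {K : J → Sys α →L[ℂ] Sys α'} (hK : IsMeasurement K)
    (Φ : Sys (α × β)) :
    ∑' j, ENNReal.ofReal (‖actA (K j) Φ‖ ^ 2) = ENNReal.ofReal (‖Φ‖ ^ 2) := by
  simp_rw [← tsum_norm_sq_sliceB]
  rw [ENNReal.tsum_comm]
  exact tsum_congr fun b => hK.tsum_eq (sliceB Φ b)

theorem IsMeasurement.tsum_actB {J : Type} {K : J → Sys β →L[ℂ] Sys β'} (hK : IsMeasurement K)
    (Φ : Sys (α × β)) :
    ∑' j, ENNReal.ofReal (‖actB (K j) Φ‖ ^ 2) = ENNReal.ofReal (‖Φ‖ ^ 2) := by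
  simp_rw [← tsum_norm_sq_sliceA]
  rw [ENNReal.tsum_comm]
  exact tsum_congr fun a => hK.tsum_eq (sliceA Φ a)

/-- LOCC protocols with at most `n` rounds that turn a system `α × β` into a system `α' × β'`. In
each round one party performs a measurement on its own system and announces the outcome; all later
steps may depend on it. The spaces may change in each round (local ancillas can be added or
discarded). Coarse-grained outcomes are obtained by forgetting part of the record. -/
inductive LOCC (α' β' : Type) : ℕ → Type → Type → Type 1
  | done {n : ℕ} : LOCC α' β' n α' β'
  | alice {n : ℕ} {α β α₁ J : Type} (K : J → Sys α →L[ℂ] Sys α₁) (hK : IsMeasurement K)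
      (next : J → LOCC α' β' n α₁ β) : LOCC α' β' (n + 1) α β
  | bob {n : ℕ} {α β β₁ J : Type} (K : J → Sys β →L[ℂ] Sys β₁) (hK : IsMeasurement K)
      (next : J → LOCC α' β' n α β₁) : LOCC α' β' (n + 1) α β

namespace LOCC

/-- The complete measurement records of a protocol. -/
def Record : {n : ℕ} → {α β : Type} → LOCC α' β' n α β → Type
  | _, _, _, done => Unit
  | _, _, _, alice (J := J) _ _ next => Σ j : J, (next j).Record
  | _, _, _, bob (J := J) _ _ next => Σ j : J, (next j).Record

/-- The unnormalized final vector, on the initial vector `Φ`, for each measurement record. -/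
def final : {n : ℕ} → {α β : Type} → (P : LOCC α' β' n α β) → Sys (α × β) → P.Record →
    Sys (α' × β')
  | _, _, _, done, Φ, _ => Φ
  | _, _, _, alice K _ next, Φ, ω => (next ω.1).final (actA (K ω.1) Φ) ω.2
  | _, _, _, bob K _ next, Φ, ω => (next ω.1).final (actB (K ω.1) Φ) ω.2

/-- LOCC operations preserve the trace. -/
theorem tsum_final : {n : ℕ} → {α β : Type} → (P : LOCC α' β' n α β) → (Φ : Sys (α × β)) →
    ∑' ω, ENNReal.ofReal (‖P.final Φ ω‖ ^ 2) = ENNReal.ofReal (‖Φ‖ ^ 2)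
  | _, _, _, done, Φ => by
    change ∑' _ : Unit, ENNReal.ofReal (‖Φ‖ ^ 2) = _
    simp
  | _, _, _, alice K hK next, Φ => by
    rw [← hK.tsum_actA Φ]
    refine (ENNReal.tsum_sigma' _).trans (tsum_congr fun j => ?_)
    exact tsum_final (next j) (actA (K j) Φ)
  | _, _, _, bob K hK next, Φ => by
    rw [← hK.tsum_actB Φ]
    refine (ENNReal.tsum_sigma' _).trans (tsum_congr fun j => ?_)
    exact tsum_final (next j) (actB (K j) Φ)

variable {n : ℕ}

/-- The series of final states converges absolutely in operator norm. -/
theorem summable_final (P : LOCC α' β' n α β) (Φ : Sys (α × β)) :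
    Summable fun ω => ketbra (P.final Φ ω) := by
  refine Summable.of_norm ?_
  have h : Summable fun ω => ‖P.final Φ ω‖ ^ 2 := by
    have := ENNReal.summable_toReal (f := fun ω => ENNReal.ofReal (‖P.final Φ ω‖ ^ 2))
      (by rw [tsum_final]; exact ENNReal.ofReal_ne_top)
    refine this.congr fun ω => ?_
    exact ENNReal.toReal_ofReal (sq_nonneg _)
  refine h.congr fun ω => ?_
  simp [ketbra, sq]

/-- The unnormalized final state `I_S(Φ)` for the event that the record lies in `S`. For
`S = Set.univ` this is the final state `C(Φ)` of the quantum operation without selection. -/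
def output (P : LOCC α' β' n α β) (Φ : Sys (α × β)) (S : Set P.Record) :
    Sys (α' × β') →L[ℂ] Sys (α' × β') := ∑' ω : S, ketbra (P.final Φ ω)

/-- The probability `Tr I_S(Φ)` of the event that the record lies in `S`. -/
def prob (P : LOCC α' β' n α β) (Φ : Sys (α × β)) (S : Set P.Record) : ℝ≥0∞ :=
  ∑' ω : S, ENNReal.ofReal (‖P.final Φ ω‖ ^ 2)

end LOCC

/-! ### Fixed-length entanglement concentration -/

/-- A deterministic fixed-length entanglement concentration: an LOCC operation together with a
maximally entangled target state. -/
structure DFLEC (α β : Type) where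
  outA : Type
  outB : Type
  rounds : ℕ
  op : LOCC outA outB rounds α β
  size : ℕ
  target : Sys (outA × outB)
  target_spec : IsMaxEntangled target size

/-- The fidelity `⟨Ψ| C(Φ) |Ψ⟩`. -/
def DFLEC.fidelity (D : DFLEC α β) (Φ : Sys (α × β)) : ℝ≥0∞ :=
  ENNReal.ofReal (inner ℂ D.target (D.op.output Φ Set.univ D.target)).re

/-- A probabilistic fixed-length entanglement concentration of `Φ`: a two-valued LOCC instrument
`(I₀, I₁)`, where `I₁` corresponds to the records in `success`, with
`I₁(Φ) = Tr I₁(Φ) • |Ψ⟩⟨Ψ|` for a maximally entangled state `Ψ`. The condition is written without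
division by `Tr I₁(Φ)`; an instrument that never succeeds is thus not excluded. -/
structure PFLEC (Φ : Sys (α × β)) where
  outA : Type
  outB : Type
  rounds : ℕ
  op : LOCC outA outB rounds α β
  success : Set op.Record
  size : ℕ
  target : Sys (outA × outB)
  target_spec : IsMaxEntangled target size
  output_eq : op.output Φ success = (op.prob Φ success).toReal • ketbra target

/-- The success probability `Tr I₁(Φ)`. -/
def PFLEC.succProb {Φ : Sys (α × β)} (I : PFLEC Φ) : ℝ≥0∞ := I.op.prob Φ I.success

/-- The failure probability `Tr I₀(Φ)`. -/
def PFLEC.failProb {Φ : Sys (α × β)} (I : PFLEC Φ) : ℝ≥0∞ := I.op.prob Φ I.successᶜ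

/-! ### Asymptotic quantities -/

/-- `-(1/n) log p`, with value `+∞` at `p = 0`. -/
def expo (n : ℕ) (p : ℝ≥0∞) : EReal := -ENNReal.log p / (n : EReal)

/-- `liminf (1/n) log L_n`. -/
def rate (L : ℕ → ℕ) : EReal := liminf (fun n => ((Real.log (L n) / n : ℝ) : EReal)) atTop

variable {ι κ : ℕ → Type} (Φ : ∀ n, Sys (ι n × κ n))

/-- `B_P(ε)`. -/
def BP (ε : ℝ) : EReal :=
  ⨆ (I : ∀ n, PFLEC (Φ n))
    (_ : limsup (fun n => (I n).failProb) atTop ≤ ENNReal.ofReal ε),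
    rate fun n => (I n).size

/-- `B_{e,P}(r)`. -/
def BeP (r : ℝ) : EReal :=
  ⨆ (I : ∀ n, PFLEC (Φ n))
    (_ : (r : EReal) ≤ liminf (fun n => expo n (I n).failProb) atTop),
    rate fun n => (I n).size

/-- `B_{e,P}^*(r)`. -/
def BePStar (r : ℝ) : EReal :=
  ⨆ (I : ∀ n, PFLEC (Φ n))
    (_ : limsup (fun n => expo n (I n).succProb) atTop ≤ (r : EReal)),
    rate fun n => (I n).size

/-- `B_D(ε)`. -/
def BD (ε : ℝ) : EReal :=
  ⨆ (D : ∀ n, DFLEC (ι n) (κ n))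
    (_ : ENNReal.ofReal (1 - ε) ≤ liminf (fun n => (D n).fidelity (Φ n)) atTop),
    rate fun n => (D n).size

/-- `B_{e,D}(r)`. -/
def BeD (r : ℝ) : EReal :=
  ⨆ (D : ∀ n, DFLEC (ι n) (κ n))
    (_ : (r : EReal) ≤ liminf (fun n => expo n (1 - (D n).fidelity (Φ n))) atTop),
    rate fun n => (D n).size

/-- `B_{e,D}^*(r)`. -/
def BeDStar (r : ℝ) : EReal :=
  ⨆ (D : ∀ n, DFLEC (ι n) (κ n))
    (_ : limsup (fun n => expo n ((D n).fidelity (Φ n))) atTop ≤ (r : EReal)),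
    rate fun n => (D n).size

/-- `Tr ρ {ρ ∈ S}`, where `{ρ ∈ S}` is the spectral projection of the reduced density `ρ`: the sum
of the eigenvalues of `ρ` in `S`, each counted with its multiplicity. -/
def specMass (ρ : Sys α →L[ℂ] Sys α) (S : Set ℝ) : ℝ≥0∞ :=
  ∑' x : S, ENNReal.ofReal x *
    (Module.finrank ℂ (Module.End.eigenspace (ρ : Sys α →ₗ[ℂ] Sys α) ((x : ℝ) : ℂ)) : ℝ≥0∞)

/-- `K(a) = limsup Tr ρ_n {ρ_n ≥ e^{-na}}`. -/
def K (a : ℝ) : ℝ≥0∞ :=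
  limsup (fun n : ℕ => specMass (reduced (Φ n)) (Set.Ici (Real.exp (-n * a)))) atTop

/-- `liminf -(1/n) log Tr ρ_n {ρ_n > e^{-na}}`. -/
def zetaC (a : ℝ) : EReal :=
  liminf (fun n : ℕ => expo n (specMass (reduced (Φ n)) (Set.Ioi (Real.exp (-n * a))))) atTop

/-- For every real `a`, the limit of `-(1/n) log Tr ρ_n {ρ_n < e^{-na}}` exists in `[0, ∞]` and
equals `ζ a`. -/
def IsZeta (ζ : ℝ → EReal) : Prop :=
  ∀ a : ℝ, Tendsto
    (fun n : ℕ => expo n (specMass (reduced (Φ n)) (Set.Iio (Real.exp (-n * a)))))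
    atTop (𝓝 (ζ a))

/-- `inf_{a' ≤ a} (ζ(a') - a'/2)`. -/
def infHalf (ζ : ℝ → EReal) (a : ℝ) : EReal :=
  ⨅ (a' : ℝ) (_ : a' ≤ a), (ζ a' - ((a' / 2 : ℝ) : EReal))

end EntConc

end

/-!
The eigenvalues of the reduced density of `Φ` are the squared Schmidt coefficients of `Φ`.

*Achievability.* Let finitely many eigenvalues `p i` have sum `m`, with `M * p i ≤ m` for all `i`.
Then the weights `M * p i / m` lie in `[0, 1]` and sum to `M`, so by Birkhoff's theorem they are the
average of the indicators of sets of `M` indices. A corresponding measurement by the first party,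
followed by a correction by the second, turns `Φ` into a maximally entangled state of size `M` with
probability `m`. Applied to the eigenvalues below `x`, this gives a size of about `m / x`.

*Converse.* LOCC does not increase the Schmidt rank, and a unit vector of Schmidt rank `k` has
squared overlap at most `k / L` with a maximally entangled state of size `L`. The part of `Φ` with
eigenvalues at least `x` has Schmidt rank at most `1 / x`, so at sizes much larger than `1 / x` the
fidelity is bounded by the mass of the eigenvalues below `x`. In the strong converse regime the
spectrum is cut at several thresholds `e^{-na}` instead of one, each block between neighbouring
thresholds is estimated in this way, and their number is a factor independent of `n`.

With `x = e^{-na}` and `n → ∞` both bounds become inequalities between exponents. A probabilistic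
concentration is in particular a deterministic one, with fidelity at least its success probability.
In the strong converse regime a deterministic concentration does better by aiming at a size `L`
larger than the size `M` of the state it produces, at the cost of a factor `M / L` in fidelity;
this trade-off is the origin of the infimum over `ζ a' - a' / 2`.
-/

noncomputable section

namespace EntConc

section Spectral

variable {α β J : Type}

theorem ketbra_apply (x y : Sys α) : ketbra x y = inner ℂ x y • x :=
  InnerProductSpace.rankOne_apply x x y

theorem hasSum_inner_tsum_ketbra {v : J → Sys α} (hv : Summable fun j => ketbra (v j))
    (x y : Sys α) :
    HasSum (fun j => inner ℂ (v j) x * inner ℂ y (v j))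
      (inner ℂ y ((∑' j, ketbra (v j)) x)) := by
  have h := (innerSL ℂ y).hasSum ((ContinuousLinearMap.apply ℂ (Sys α) x).hasSum hv.hasSum)
  simpa [ketbra_apply, inner_smul_right] using h

theorem hasSum_norm_inner_sq_tsum_ketbra {v : J → Sys α} (hv : Summable fun j => ketbra (v j))
    (x : Sys α) :
    HasSum (fun j => ‖inner ℂ x (v j)‖ ^ 2) (inner ℂ x ((∑' j, ketbra (v j)) x)).re := by
  refine (Complex.hasSum_re (hasSum_inner_tsum_ketbra hv x x)).congr_fun fun j => ?_
  have h : (inner ℂ (v j) x * inner ℂ x (v j)).re = _ :=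
    inner_mul_symm_re_eq_norm (𝕜 := ℂ) (v j) x
  rw [h, norm_mul, norm_inner_symm, sq]

theorem isPositive_tsum_ketbra (v : J → Sys α) : (∑' j, ketbra (v j)).IsPositive :=
  (ContinuousLinearMap.nonneg_iff_isPositive _).mp <| tsum_nonneg fun j =>
    (ContinuousLinearMap.nonneg_iff_isPositive _).mpr
      (InnerProductSpace.isPositive_rankOne_self (v j))

theorem isCompactOperator_ketbra (x : Sys α) : IsCompactOperator (ketbra x) :=
  (isCompactOperator_of_locallyCompactSpace_dom (innerSL ℂ x)).clm_comp
    (ContinuousLinearMap.toSpanSingleton ℂ x)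

theorem isCompactOperator_tsum_ketbra {v : J → Sys α} (hv : Summable fun j => ketbra (v j)) :
    IsCompactOperator ⇑(∑' j, ketbra (v j)) :=
  isCompactOperator_of_tendsto hv.hasSum <| Eventually.of_forall fun _ =>
    (compactOperator (RingHom.id ℂ) (Sys α) (Sys α)).sum_mem fun j _ =>
      isCompactOperator_ketbra (v j)

theorem apply_eq_zero_of_orthogonal_eigenvectors {𝕜 E : Type*} [RCLike 𝕜]
    [NormedAddCommGroup E] [InnerProductSpace 𝕜 E] [CompleteSpace E]
    {T : E →L[𝕜] E} (hcpt : IsCompactOperator T) (hpos : T.IsPositive) {y : E}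
    (hy : ∀ x : ℝ, 0 < x → ∀ v, T v = (x : 𝕜) • v → inner 𝕜 v y = 0) : T y = 0 := by
  have hmem : T y ∈ (⨆ μ, Module.End.eigenspace (T : E →ₗ[𝕜] E) μ)ᗮ := by
    rw [← Submodule.iInf_orthogonal, Submodule.mem_iInf]
    intro μ
    rw [Submodule.mem_orthogonal]
    intro v hv
    by_cases hv0 : v = 0
    · rw [hv0, inner_zero_left]
    have hTv : T v = μ • v := Module.End.mem_eigenspace_iff.mp hv
    have heig : Module.End.HasEigenvalue (T : E →ₗ[𝕜] E) μ :=
      Module.End.hasEigenvalue_of_hasEigenvector ⟨hv, hv0⟩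
    obtain ⟨x, rfl⟩ := RCLike.conj_eq_iff_real.mp (hpos.isSymmetric.conj_eigenvalue_eq_self heig)
    have hsymm : inner 𝕜 v (T y) = inner 𝕜 (T v) y := (hpos.isSymmetric v y).symm
    rw [hsymm, hTv, inner_smul_left]
    rcases (eigenvalue_nonneg_of_nonneg heig hpos.re_inner_nonneg_right).eq_or_lt with rfl | hx
    · rw [RCLike.ofReal_zero, map_zero, zero_mul]
    · rw [hy x hx v hTv, mul_zero]
  rwa [ContinuousLinearMap.orthogonalComplement_iSup_eigenspaces_eq_bot hcpt hpos.isSymmetric,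
    Submodule.mem_bot] at hmem

theorem tsum_norm_inner_sq_eq_of_orthonormal {𝕜 E I : Type*} [RCLike 𝕜]
    [NormedAddCommGroup E] [InnerProductSpace 𝕜 E] [CompleteSpace E]
    {e : I → E} (he : Orthonormal 𝕜 e) {x : E}
    (hx : ∀ y, (∀ i, inner 𝕜 (e i) y = 0) → inner 𝕜 y x = 0) :
    ∑' i, ENNReal.ofReal (‖inner 𝕜 (e i) x‖ ^ 2) = ENNReal.ofReal (‖x‖ ^ 2) := by
  obtain ⟨w, B, hw, hB⟩ := he.toSubtypeRange.exists_hilbertBasis_extension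
  have hparseval : ∑' z : w, ENNReal.ofReal (‖inner 𝕜 (z : E) x‖ ^ 2) =
      ENNReal.ofReal (‖x‖ ^ 2) := by
    have h : HasSum (fun z : w => ‖inner 𝕜 (z : E) x‖ ^ 2) (‖x‖ ^ 2) := by
      have h := RCLike.hasSum_re 𝕜 (B.hasSum_inner_mul_inner x x)
      simpa only [inner_mul_symm_re_eq_norm, norm_mul, norm_inner_symm x, ← sq, hB,
        inner_self_eq_norm_sq] using h
    rw [← h.tsum_eq, ENNReal.ofReal_tsum_of_nonneg (fun _ => sq_nonneg _) h.summable]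
  rw [← hparseval]
  let g : I → w := fun i => ⟨e i, hw ⟨i, rfl⟩⟩
  have hg : Function.Injective g := fun i j h =>
    he.linearIndependent.injective (congrArg Subtype.val h)
  refine hg.tsum_eq (f := fun z : w => ENNReal.ofReal (‖inner 𝕜 (z : E) x‖ ^ 2)) ?_
  intro z hz
  by_contra hzr
  refine hz ?_
  have hzx : inner 𝕜 (z : E) x = 0 := hx z fun i =>
    (hB ▸ B.orthonormal).2 (i := g i) (j := z) fun h => hzr ⟨i, h⟩
  simp [hzx]

variable (Φ : Sys (α × β))

theorem hasSum_norm_inner_sq_sliceB (x : Sys α) :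
    HasSum (fun b => ‖inner ℂ x (sliceB Φ b)‖ ^ 2) (inner ℂ x (reduced Φ x)).re :=
  hasSum_norm_inner_sq_tsum_ketbra (summable_reduced Φ) x

theorem isPositive_reduced : (reduced Φ).IsPositive := isPositive_tsum_ketbra _

theorem isCompactOperator_reduced : IsCompactOperator (reduced Φ) :=
  isCompactOperator_tsum_ketbra (summable_reduced Φ)

/-- The eigenspace of the reduced density for a positive eigenvalue. -/
def posEigenspace (x : {x : ℝ // 0 < x}) : Submodule ℂ (Sys α) :=
  Module.End.eigenspace (reduced Φ : Sys α →ₗ[ℂ] Sys α) ((x : ℝ) : ℂ)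

instance (x : {x : ℝ // 0 < x}) : FiniteDimensional ℂ (posEigenspace Φ x) :=
  ContinuousLinearMap.finite_dimensional_eigenspace (isCompactOperator_reduced Φ) _
    (by exact_mod_cast x.2.ne')

/-- An index for the positive eigenvalues of the reduced density, each repeated according to its
multiplicity. -/
abbrev EigenIndex : Type :=
  Σ x : {x : ℝ // 0 < x}, Fin (Module.finrank ℂ (posEigenspace Φ x))

/-- The positive eigenvalues of the reduced density, repeated according to multiplicity. -/
def eigenval (i : EigenIndex Φ) : ℝ := i.1

/-- An orthonormal system of eigenvectors for the positive eigenvalues of the reduced density; it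
spans the closure of the range. -/
def eigenvec (i : EigenIndex Φ) : Sys α :=
  (stdOrthonormalBasis ℂ (posEigenspace Φ i.1) i.2 : posEigenspace Φ i.1)

theorem eigenval_pos (i : EigenIndex Φ) : 0 < eigenval Φ i := i.1.2

theorem orthonormal_eigenvec : Orthonormal ℂ (eigenvec Φ) := by
  refine ⟨fun i => (stdOrthonormalBasis ℂ (posEigenspace Φ i.1)).orthonormal.1 i.2, ?_⟩
  rintro ⟨x, k⟩ ⟨y, l⟩ hne
  by_cases hxy : x = y
  · subst hxy
    exact (stdOrthonormalBasis ℂ (posEigenspace Φ x)).orthonormal.2 fun h =>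
      hne (Sigma.ext rfl (heq_of_eq h))
  · have hxy' : ((x : ℝ) : ℂ) ≠ ((y : ℝ) : ℂ) := fun h =>
      hxy (Subtype.ext (Complex.ofReal_injective h))
    exact (isPositive_reduced Φ).isSymmetric.orthogonalFamily_eigenspaces hxy'
      (stdOrthonormalBasis ℂ (posEigenspace Φ x) k) (stdOrthonormalBasis ℂ (posEigenspace Φ y) l)

theorem reduced_eigenvec (i : EigenIndex Φ) :
    reduced Φ (eigenvec Φ i) = (eigenval Φ i : ℂ) • eigenvec Φ i :=
  Module.End.mem_eigenspace_iff.mp (stdOrthonormalBasis ℂ (posEigenspace Φ i.1) i.2).2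

theorem hasSum_norm_inner_sq_eigenvec (i : EigenIndex Φ) :
    HasSum (fun b => ‖inner ℂ (eigenvec Φ i) (sliceB Φ b)‖ ^ 2) (eigenval Φ i) := by
  have h := hasSum_norm_inner_sq_sliceB Φ (eigenvec Φ i)
  rwa [reduced_eigenvec, inner_smul_right, inner_self_eq_norm_sq_to_K,
    (orthonormal_eigenvec Φ).1 i, RCLike.ofReal_one, one_pow, mul_one, Complex.ofReal_re] at h

variable {Φ} in
theorem inner_eq_zero_of_forall_eigenvec {y : Sys α} (hy : ∀ i, inner ℂ (eigenvec Φ i) y = 0)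
    {x : ℝ} (hx : 0 < x) {v : Sys α} (hv : reduced Φ v = (x : ℂ) • v) : inner ℂ v y = 0 := by
  let B := stdOrthonormalBasis ℂ (posEigenspace Φ ⟨x, hx⟩)
  let v' : posEigenspace Φ ⟨x, hx⟩ := ⟨v, Module.End.mem_eigenspace_iff.mpr hv⟩
  have hsum : ∑ k, B.repr v' k • eigenvec Φ ⟨⟨x, hx⟩, k⟩ = v :=
    (map_sum (Submodule.subtype _) _ _).symm.trans (congrArg (Submodule.subtype _) (B.sum_repr v'))
  rw [← hsum, sum_inner]
  exact Finset.sum_eq_zero fun k _ => by rw [inner_smul_left, hy, mul_zero]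

variable {Φ} in
theorem inner_sliceB_eq_zero_of_forall_eigenvec {y : Sys α}
    (hy : ∀ i, inner ℂ (eigenvec Φ i) y = 0) (b : β) : inner ℂ y (sliceB Φ b) = 0 := by
  have hker : reduced Φ y = 0 :=
    apply_eq_zero_of_orthogonal_eigenvectors (isCompactOperator_reduced Φ) (isPositive_reduced Φ)
      fun _ hx _ hv => inner_eq_zero_of_forall_eigenvec hy hx hv
  have h := hasSum_norm_inner_sq_sliceB Φ y
  rw [hker, inner_zero_right, Complex.zero_re,
    hasSum_zero_iff_of_nonneg fun _ => sq_nonneg _] at h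
  simpa using congrFun h b

theorem tsum_eigenval : ∑' i, ENNReal.ofReal (eigenval Φ i) = ENNReal.ofReal (‖Φ‖ ^ 2) :=
  calc ∑' i, ENNReal.ofReal (eigenval Φ i)
      = ∑' i, ∑' b, ENNReal.ofReal (‖inner ℂ (eigenvec Φ i) (sliceB Φ b)‖ ^ 2) :=
        tsum_congr fun i => by
          have h := hasSum_norm_inner_sq_eigenvec Φ i
          rw [← h.tsum_eq, ENNReal.ofReal_tsum_of_nonneg (fun _ => sq_nonneg _) h.summable]
    _ = ∑' b, ∑' i, ENNReal.ofReal (‖inner ℂ (eigenvec Φ i) (sliceB Φ b)‖ ^ 2) :=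
        ENNReal.tsum_comm
    _ = ∑' b, ENNReal.ofReal (‖sliceB Φ b‖ ^ 2) := tsum_congr fun b =>
        tsum_norm_inner_sq_eq_of_orthonormal (orthonormal_eigenvec Φ) fun _ hy =>
          inner_sliceB_eq_zero_of_forall_eigenvec hy b
    _ = ENNReal.ofReal (‖Φ‖ ^ 2) := tsum_norm_sq_sliceB Φ

theorem specMass_eq_tsum_eigenval (S : Set ℝ) :
    specMass (reduced Φ) S =
      ∑' i, (eigenval Φ ⁻¹' S).indicator (fun i => ENNReal.ofReal (eigenval Φ i)) i := by
  let m : ℝ → ℝ≥0∞ := fun x => ENNReal.ofReal x *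
    (Module.finrank ℂ (Module.End.eigenspace (reduced Φ : Sys α →ₗ[ℂ] Sys α) (x : ℂ)) : ℝ≥0∞)
  have hfiber : ∀ x : {x : ℝ // 0 < x}, ∑' k : Fin (Module.finrank ℂ (posEigenspace Φ x)),
      (eigenval Φ ⁻¹' S).indicator (fun i => ENNReal.ofReal (eigenval Φ i)) ⟨x, k⟩ =
        S.indicator m x := by
    intro x
    by_cases hx : (x : ℝ) ∈ S
    · have hmem : ∀ k, (⟨x, k⟩ : EigenIndex Φ) ∈ eigenval Φ ⁻¹' S := fun _ => hx
      simp only [Set.indicator_of_mem hx, Set.indicator_of_mem (hmem _)]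
      have hval : ∀ k, ENNReal.ofReal (eigenval Φ ⟨x, k⟩) = ENNReal.ofReal x := fun _ => rfl
      rw [tsum_congr hval, tsum_fintype, Finset.sum_const, nsmul_eq_mul, mul_comm, Finset.card_fin]
      rfl
    · have hmem : ∀ k, (⟨x, k⟩ : EigenIndex Φ) ∉ eigenval Φ ⁻¹' S := fun _ => hx
      simp only [Set.indicator_of_notMem hx, Set.indicator_of_notMem (hmem _), tsum_zero]
  have hsupp : Function.support (S.indicator m) ⊆ Set.range ((↑) : {x : ℝ // 0 < x} → ℝ) := by
    intro x hx
    by_contra hx0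
    have hx0 : x ≤ 0 := by simpa using hx0
    exact hx (by simp [m, Set.indicator, ENNReal.ofReal_of_nonpos hx0])
  rw [ENNReal.tsum_sigma', tsum_congr hfiber, Subtype.val_injective.tsum_eq hsupp]
  exact tsum_subtype S m

end Spectral

section Tensor

variable {α β α' β' : Type}

/-- The product vector `u ⊗ v`. -/
def tens (u : Sys α) (v : Sys β) : Sys (α × β) :=
  ⟨fun p => u p.1 * v p.2, memℓp_of_summable_sq (by
    simpa [mul_pow] using (summable_sq u).mul_of_nonneg (summable_sq v)
      (fun _ => sq_nonneg _) (fun _ => sq_nonneg _))⟩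

/-- The partial contraction `(⟨x| ⊗ 1) Φ`. -/
def contr (x : Sys α) (Φ : Sys (α × β)) : Sys β :=
  ⟨fun b => inner ℂ x (sliceB Φ b), memℓp_of_summable_sq (hasSum_norm_inner_sq_sliceB Φ x).summable⟩

@[simp] theorem tens_apply (u : Sys α) (v : Sys β) (p : α × β) : tens u v p = u p.1 * v p.2 := rfl

@[simp] theorem contr_apply (x : Sys α) (Φ : Sys (α × β)) (b : β) :
    contr x Φ b = inner ℂ x (sliceB Φ b) := rfl

@[simp] theorem sliceB_apply (Φ : Sys (α × β)) (b : β) (a : α) : sliceB Φ b a = Φ (a, b) := rfl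

@[simp] theorem sliceA_apply (Φ : Sys (α × β)) (a : α) (b : β) : sliceA Φ a b = Φ (a, b) := rfl

@[simp] theorem actA_apply (A : Sys α →L[ℂ] Sys α') (Φ : Sys (α × β)) (p : α' × β) :
    actA A Φ p = A (sliceB Φ p.2) p.1 := rfl

@[simp] theorem actB_apply (B : Sys β →L[ℂ] Sys β') (Φ : Sys (α × β)) (p : α × β') :
    actB B Φ p = B (sliceA Φ p.1) p.2 := rfl

theorem sliceB_add (Φ Φ' : Sys (α × β)) (b : β) :
    sliceB (Φ + Φ') b = sliceB Φ b + sliceB Φ' b := rfl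

theorem sliceA_add (Φ Φ' : Sys (α × β)) (a : α) :
    sliceA (Φ + Φ') a = sliceA Φ a + sliceA Φ' a := rfl

theorem actA_add (A : Sys α →L[ℂ] Sys α') (Φ Φ' : Sys (α × β)) :
    actA A (Φ + Φ') = actA A Φ + actA A Φ' := by
  ext p
  simp [sliceB_add]

theorem actB_add (B : Sys β →L[ℂ] Sys β') (Φ Φ' : Sys (α × β)) :
    actB B (Φ + Φ') = actB B Φ + actB B Φ' := by
  ext p
  simp [sliceA_add]

theorem sliceB_tens (u : Sys α) (v : Sys β) (b : β) : sliceB (tens u v) b = v b • u := by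
  ext a
  simp [mul_comm]

theorem sliceA_tens (u : Sys α) (v : Sys β) (a : α) : sliceA (tens u v) a = u a • v := by
  ext b
  simp

theorem actA_tens (A : Sys α →L[ℂ] Sys α') (u : Sys α) (v : Sys β) :
    actA A (tens u v) = tens (A u) v := by
  ext p
  simp [sliceB_tens, mul_comm]

theorem actB_tens (B : Sys β →L[ℂ] Sys β') (u : Sys α) (v : Sys β) :
    actB B (tens u v) = tens u (B v) := by
  ext p
  simp [sliceA_tens]

theorem actA_sum {J : Type} (A : Sys α →L[ℂ] Sys α') (s : Finset J) (Φ : J → Sys (α × β)) :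
    actA A (∑ j ∈ s, Φ j) = ∑ j ∈ s, actA A (Φ j) :=
  map_sum (AddMonoidHom.mk' (actA A) (actA_add A)) Φ s

theorem actB_sum {J : Type} (B : Sys β →L[ℂ] Sys β') (s : Finset J) (Φ : J → Sys (α × β)) :
    actB B (∑ j ∈ s, Φ j) = ∑ j ∈ s, actB B (Φ j) :=
  map_sum (AddMonoidHom.mk' (actB B) (actB_add B)) Φ s

theorem tens_sum_left {J : Type} (s : Finset J) (u : J → Sys α) (v : Sys β) :
    tens (∑ j ∈ s, u j) v = ∑ j ∈ s, tens (u j) v :=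
  map_sum (AddMonoidHom.mk' (fun u => tens u v) fun u u' => by ext p; simp [add_mul]) u s

theorem tens_sum_right {J : Type} (s : Finset J) (u : Sys α) (v : J → Sys β) :
    tens u (∑ j ∈ s, v j) = ∑ j ∈ s, tens u (v j) :=
  map_sum (AddMonoidHom.mk' (fun v => tens u v) fun v v' => by ext p; simp [mul_add]) v s

theorem tens_smul_left (c : ℂ) (u : Sys α) (v : Sys β) : tens (c • u) v = tens u (c • v) := by
  ext p
  simp only [tens_apply, lp.coeFn_smul, Pi.smul_apply, smul_eq_mul]
  ring

theorem inner_tens_left (u : Sys α) (v : Sys β) (Φ : Sys (α × β)) :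
    inner ℂ (tens u v) Φ = inner ℂ v (contr u Φ) := by
  have h := lp.hasSum_inner (𝕜 := ℂ) (tens u v) Φ
  have h' := (Equiv.prodComm β α).hasSum_iff.mpr h
  refine (h'.prod_fiberwise fun b => ?_).unique (lp.hasSum_inner (𝕜 := ℂ) v (contr u Φ))
  have h2 := (lp.hasSum_inner (𝕜 := ℂ) u (sliceB Φ b)).mul_right (star (v b))
  simp only [RCLike.inner_apply, Function.comp_def, Equiv.prodComm_apply, Prod.swap,
    tens_apply, contr_apply, sliceB_apply, map_mul] at h2 ⊢
  refine h2.congr_fun fun a => ?_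
  simp only [RCLike.star_def]
  ring

theorem contr_tens (x u : Sys α) (v : Sys β) : contr x (tens u v) = inner ℂ x u • v := by
  ext b
  simp [sliceB_tens, mul_comm]

theorem inner_tens_tens (u u' : Sys α) (v v' : Sys β) :
    inner ℂ (tens u v) (tens u' v') = inner ℂ u u' * inner ℂ v v' := by
  rw [inner_tens_left, contr_tens, inner_smul_right]

theorem inner_contr_contr (Φ : Sys (α × β)) (x y : Sys α) :
    inner ℂ (contr x Φ) (contr y Φ) = inner ℂ y (reduced Φ x) := by
  refine (lp.hasSum_inner (𝕜 := ℂ) (contr x Φ) (contr y Φ)).unique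
    ((hasSum_inner_tsum_ketbra (summable_reduced Φ) x y).congr_fun fun b => ?_)
  simp only [RCLike.inner_apply, contr_apply, inner_conj_symm]
  ring

theorem inner_sum_tens {J : Type} [Fintype J] {g : J → Sys α} (hg : Orthonormal ℂ g)
    (v w : J → Sys β) :
    inner ℂ (∑ j, tens (g j) (v j)) (∑ j, tens (g j) (w j)) = ∑ j, inner ℂ (v j) (w j) := by
  classical
  simp only [sum_inner, inner_sum, inner_tens_tens]
  refine Finset.sum_congr rfl fun j _ => ?_
  simp [orthonormal_iff_ite.mp hg]

theorem norm_sq_sum_tens {J : Type} [Fintype J] {g : J → Sys α} (hg : Orthonormal ℂ g)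
    (v : J → Sys β) : ‖∑ j, tens (g j) (v j)‖ ^ 2 = ∑ j, ‖v j‖ ^ 2 := by
  have h := inner_sum_tens hg v v
  simp only [inner_self_eq_norm_sq_to_K] at h
  exact_mod_cast h

/-- The vector has Schmidt rank at most `k`. -/
def SchmidtRankLE (χ : Sys (α × β)) (k : ℕ) : Prop :=
  ∃ (u : Fin k → Sys α) (v : Fin k → Sys β), χ = ∑ i, tens (u i) (v i)

theorem SchmidtRankLE.sum_tens {J : Type} (s : Finset J) (u : J → Sys α) (v : J → Sys β) :
    SchmidtRankLE (∑ i ∈ s, tens (u i) (v i)) s.card := by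
  refine ⟨fun k => u (s.equivFin.symm k), fun k => v (s.equivFin.symm k), ?_⟩
  rw [← Finset.sum_coe_sort s,
    ← s.equivFin.symm.sum_comp fun i : s => tens (u i) (v i)]

theorem SchmidtRankLE.actA {χ : Sys (α × β)} {k : ℕ} (h : SchmidtRankLE χ k)
    (A : Sys α →L[ℂ] Sys α') : SchmidtRankLE (actA A χ) k := by
  obtain ⟨u, v, rfl⟩ := h
  exact ⟨fun i => A (u i), v, by simp [actA_sum, actA_tens]⟩

theorem SchmidtRankLE.actB {χ : Sys (α × β)} {k : ℕ} (h : SchmidtRankLE χ k)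
    (B : Sys β →L[ℂ] Sys β') : SchmidtRankLE (actB B χ) k := by
  obtain ⟨u, v, rfl⟩ := h
  exact ⟨u, fun i => B (v i), by simp [actB_sum, actB_tens]⟩

theorem SchmidtRankLE.exists_orthonormal {χ : Sys (α × β)} {k : ℕ} (h : SchmidtRankLE χ k) :
    ∃ d ≤ k, ∃ (g : Fin d → Sys α) (w : Fin d → Sys β), Orthonormal ℂ g ∧
      χ = ∑ j, tens (g j) (w j) := by
  obtain ⟨u, v, rfl⟩ := h
  let W := Submodule.span ℂ (Set.range u)
  have hW : Module.finrank ℂ W ≤ k := (finrank_range_le_card u).trans (by simp)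
  have : FiniteDimensional ℂ W := FiniteDimensional.span_of_finite ℂ (Set.finite_range u)
  let b := stdOrthonormalBasis ℂ W
  have hu : ∀ i, u i = ∑ j, b.repr ⟨u i, Submodule.subset_span ⟨i, rfl⟩⟩ j • (b j : Sys α) := by
    intro i
    have h := congrArg (Submodule.subtype W) (b.sum_repr ⟨u i, Submodule.subset_span ⟨i, rfl⟩⟩)
    rw [map_sum] at h
    exact h.symm
  refine ⟨_, hW, fun j => b j,
    fun j => ∑ i, b.repr ⟨u i, Submodule.subset_span ⟨i, rfl⟩⟩ j • v i, ?_, ?_⟩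
  · exact b.orthonormal.comp_linearIsometry W.subtypeₗᵢ
  · simp_rw [tens_sum_right, ← tens_smul_left]
    rw [Finset.sum_comm]
    refine Finset.sum_congr rfl fun i _ => ?_
    rw [← tens_sum_left, ← hu i]

theorem IsMaxEntangled.eq_smul_sum {Ψ : Sys (α × β)} {L : ℕ} (h : IsMaxEntangled Ψ L) :
    ∃ (e : Fin L → Sys α) (f : Fin L → Sys β), Orthonormal ℂ e ∧ Orthonormal ℂ f ∧
      Ψ = (((Real.sqrt L)⁻¹ : ℝ) : ℂ) • ∑ k, tens (e k) (f k) := by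
  obtain ⟨_, e, f, he, hf, h⟩ := h
  refine ⟨e, f, he, hf, ?_⟩
  ext ⟨a, b⟩
  rw [h a b, lp.coeFn_smul, Pi.smul_apply, lp.coeFn_sum, Finset.sum_apply]
  simp

theorem IsMaxEntangled.norm_eq_one {Ψ : Sys (α × β)} {L : ℕ} (h : IsMaxEntangled Ψ L) :
    ‖Ψ‖ = 1 := by
  have hL : (0 : ℝ) < L := by exact_mod_cast h.1
  obtain ⟨e, f, he, hf, rfl⟩ := h.eq_smul_sum
  have hsq : ‖∑ k, tens (e k) (f k)‖ ^ 2 = L := by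
    simpa [hf.1] using norm_sq_sum_tens he f
  rw [norm_smul, ← Real.sqrt_sq (norm_nonneg (∑ k, tens (e k) (f k))), hsq, Complex.norm_real,
    Real.norm_of_nonneg (by positivity)]
  exact inv_mul_cancel₀ (Real.sqrt_pos.mpr hL).ne'

theorem norm_inner_sum_tens_sq_le {I J : Type} [Fintype I] [Fintype J] {e : I → Sys α}
    {f : I → Sys β} (he : Orthonormal ℂ e) (hf : Orthonormal ℂ f) {g : J → Sys α}
    (hg : ∀ j, ‖g j‖ ≤ 1) (w : J → Sys β) :
    ‖inner ℂ (∑ i, tens (e i) (f i)) (∑ j, tens (g j) (w j))‖ ^ 2 ≤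
      Fintype.card J * ∑ j, ‖w j‖ ^ 2 := by
  simp only [sum_inner, inner_sum, inner_tens_tens]
  rw [← Finset.sum_product' Finset.univ Finset.univ
    (fun j i => inner ℂ (e i) (g j) * inner ℂ (f i) (w j))]
  calc _ ≤ (∑ x ∈ Finset.univ ×ˢ Finset.univ,
        ‖inner ℂ (e x.2) (g x.1)‖ * ‖inner ℂ (f x.2) (w x.1)‖) ^ 2 := by
        gcongr
        exact norm_sum_le_of_le _ fun x _ => (norm_mul _ _).le
    _ ≤ (∑ x ∈ Finset.univ ×ˢ Finset.univ, ‖inner ℂ (e x.2) (g x.1)‖ ^ 2) *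
        ∑ x ∈ Finset.univ ×ˢ Finset.univ, ‖inner ℂ (f x.2) (w x.1)‖ ^ 2 :=
        Finset.sum_mul_sq_le_sq_mul_sq _ _ _
    _ ≤ (∑ j, ‖g j‖ ^ 2) * ∑ j, ‖w j‖ ^ 2 := by
        rw [Finset.sum_product, Finset.sum_product]
        gcongr with j _ j _
        · exact he.sum_inner_products_le (g j)
        · exact hf.sum_inner_products_le (w j)
    _ ≤ Fintype.card J * ∑ j, ‖w j‖ ^ 2 := by
        gcongr
        simpa using Finset.sum_le_card_nsmul Finset.univ _ 1 fun j _ =>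
          pow_le_one₀ (norm_nonneg _) (hg j)

theorem IsMaxEntangled.norm_inner_sq_le {Ψ χ : Sys (α × β)} {L k : ℕ} (h : IsMaxEntangled Ψ L)
    (hχ : SchmidtRankLE χ k) : ‖inner ℂ Ψ χ‖ ^ 2 ≤ k / L * ‖χ‖ ^ 2 := by
  obtain ⟨e, f, he, hf, rfl⟩ := h.eq_smul_sum
  obtain ⟨d, hd, g, w, hg, rfl⟩ := hχ.exists_orthonormal
  calc ‖inner ℂ ((((Real.sqrt L)⁻¹ : ℝ) : ℂ) • ∑ k, tens (e k) (f k)) (∑ j, tens (g j) (w j))‖ ^ 2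
      = (L : ℝ)⁻¹ * ‖inner ℂ (∑ k, tens (e k) (f k)) (∑ j, tens (g j) (w j))‖ ^ 2 := by
        rw [inner_smul_left, norm_mul, mul_pow, RCLike.norm_conj, Complex.norm_real,
          Real.norm_of_nonneg (by positivity), inv_pow, Real.sq_sqrt (Nat.cast_nonneg L)]
    _ ≤ (L : ℝ)⁻¹ * (k * ∑ j, ‖w j‖ ^ 2) := by
        gcongr
        refine (norm_inner_sum_tens_sq_le he hf (fun j => (hg.1 j).le) w).trans ?_
        rw [Fintype.card_fin]
        gcongr
    _ = k / L * ‖∑ j, tens (g j) (w j)‖ ^ 2 := by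
        rw [norm_sq_sum_tens hg]
        ring

theorem IsMaxEntangled.le_norm_smul_sub_sq {Ψ χ : Sys (α × β)} {L k : ℕ}
    (h : IsMaxEntangled Ψ L) (hχ : SchmidtRankLE χ k) (c : ℂ) :
    ‖c‖ ^ 2 * (1 - k / L) ≤ ‖c • Ψ - χ‖ ^ 2 := by
  have hk : (0 : ℝ) ≤ k / L := by positivity
  rw [@norm_sub_sq ℂ, norm_smul, h.norm_eq_one, mul_one]
  have hre : RCLike.re (inner ℂ (c • Ψ) χ) ≤ ‖c‖ * ‖inner ℂ Ψ χ‖ := by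
    refine (RCLike.re_le_norm _).trans (le_of_eq ?_)
    rw [inner_smul_left, norm_mul, RCLike.norm_conj]
  have hinner : ‖inner ℂ Ψ χ‖ ≤ Real.sqrt (k / L) * ‖χ‖ :=
    (pow_le_pow_iff_left₀ (norm_nonneg _) (by positivity) two_ne_zero).mp
      (by rw [mul_pow, Real.sq_sqrt hk]; exact h.norm_inner_sq_le hχ)
  nlinarith [sq_nonneg (‖c‖ * Real.sqrt (k / L) - ‖χ‖), Real.sq_sqrt hk,
    mul_le_mul_of_nonneg_left hinner (norm_nonneg c)]

end Tensor

section Converse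

variable {α β α' β' : Type}

theorem norm_add_sq_le_weighted {E : Type*} [SeminormedAddCommGroup E] {c : ℝ} (hc : 0 < c)
    (x y : E) : ‖x + y‖ ^ 2 ≤ (1 + 1 / c) * ‖x‖ ^ 2 + (1 + c) * ‖y‖ ^ 2 :=
  calc ‖x + y‖ ^ 2 ≤ (‖x‖ + ‖y‖) ^ 2 := by gcongr; exact norm_add_le x y
    _ ≤ (‖x‖ + ‖y‖) ^ 2 + (‖x‖ - c * ‖y‖) ^ 2 / c := le_add_of_nonneg_right (by positivity)
    _ = (1 + 1 / c) * ‖x‖ ^ 2 + (1 + c) * ‖y‖ ^ 2 := by field_simp; ring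

namespace LOCC

theorem final_add : {n : ℕ} → {α β : Type} → (P : LOCC α' β' n α β) → (Φ Φ' : Sys (α × β)) →
    (ω : P.Record) → P.final (Φ + Φ') ω = P.final Φ ω + P.final Φ' ω
  | _, _, _, done, _, _, _ => rfl
  | _, _, _, alice K _ next, Φ, Φ', ω => by
    change (next ω.1).final (actA (K ω.1) (Φ + Φ')) ω.2 = _
    rw [actA_add, final_add (next ω.1)]
    rfl
  | _, _, _, bob K _ next, Φ, Φ', ω => by
    change (next ω.1).final (actB (K ω.1) (Φ + Φ')) ω.2 = _
    rw [actB_add, final_add (next ω.1)]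
    rfl

theorem schmidtRankLE_final {k : ℕ} : {n : ℕ} → {α β : Type} → (P : LOCC α' β' n α β) →
    {Φ : Sys (α × β)} → SchmidtRankLE Φ k → (ω : P.Record) → SchmidtRankLE (P.final Φ ω) k
  | _, _, _, done, _, h, _ => h
  | _, _, _, alice K _ next, _, h, ω => schmidtRankLE_final (next ω.1) (h.actA (K ω.1)) ω.2
  | _, _, _, bob K _ next, _, h, ω => schmidtRankLE_final (next ω.1) (h.actB (K ω.1)) ω.2

variable {n : ℕ}

theorem final_sum {J : Type} (P : LOCC α' β' n α β) (s : Finset J) (Φ : J → Sys (α × β))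
    (ω : P.Record) : P.final (∑ j ∈ s, Φ j) ω = ∑ j ∈ s, P.final (Φ j) ω :=
  map_sum (AddMonoidHom.mk' (fun Φ => P.final Φ ω) fun Φ Φ' => P.final_add Φ Φ' ω) Φ s

theorem hasSum_norm_inner_sq_output (P : LOCC α' β' n α β) (Φ : Sys (α × β))
    (S : Set P.Record) (x : Sys (α' × β')) :
    HasSum (fun ω : S => ‖inner ℂ x (P.final Φ ω)‖ ^ 2) (inner ℂ x (P.output Φ S x)).re :=
  hasSum_norm_inner_sq_tsum_ketbra ((P.summable_final Φ).subtype S) x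

/-- The total squared overlap of the final vectors with `Ψ`. -/
def overlap (P : LOCC α' β' n α β) (Ψ : Sys (α' × β')) (Φ : Sys (α × β)) : ℝ≥0∞ :=
  ∑' ω, ENNReal.ofReal (‖inner ℂ Ψ (P.final Φ ω)‖ ^ 2)

theorem overlap_le_norm_sq (P : LOCC α' β' n α β) {Ψ : Sys (α' × β')} (hΨ : ‖Ψ‖ = 1)
    (Φ : Sys (α × β)) : P.overlap Ψ Φ ≤ ENNReal.ofReal (‖Φ‖ ^ 2) := by
  rw [← P.tsum_final Φ]
  refine ENNReal.tsum_le_tsum fun ω => ENNReal.ofReal_le_ofReal ?_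
  gcongr
  simpa [hΨ] using norm_inner_le_norm (𝕜 := ℂ) Ψ (P.final Φ ω)

theorem overlap_le_of_schmidtRankLE (P : LOCC α' β' n α β) {Ψ : Sys (α' × β')} {L k : ℕ}
    (hΨ : IsMaxEntangled Ψ L) {Φ : Sys (α × β)} (hΦ : SchmidtRankLE Φ k) :
    P.overlap Ψ Φ ≤ ENNReal.ofReal (k / L * ‖Φ‖ ^ 2) := by
  rw [ENNReal.ofReal_mul (by positivity), ← P.tsum_final Φ, ← ENNReal.tsum_mul_left]
  refine ENNReal.tsum_le_tsum fun ω => ?_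
  rw [← ENNReal.ofReal_mul (by positivity)]
  exact ENNReal.ofReal_le_ofReal (hΨ.norm_inner_sq_le (P.schmidtRankLE_final hΦ ω))

theorem overlap_add_le (P : LOCC α' β' n α β) (Ψ : Sys (α' × β')) (Φ Φ' : Sys (α × β))
    {c : ℝ} (hc : 0 < c) : P.overlap Ψ (Φ + Φ') ≤
      ENNReal.ofReal (1 + 1 / c) * P.overlap Ψ Φ + ENNReal.ofReal (1 + c) * P.overlap Ψ Φ' := by
  rw [overlap, overlap, overlap, ← ENNReal.tsum_mul_left, ← ENNReal.tsum_mul_left,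
    ← ENNReal.tsum_add]
  refine ENNReal.tsum_le_tsum fun ω => ?_
  rw [← ENNReal.ofReal_mul (by positivity), ← ENNReal.ofReal_mul (by positivity),
    ← ENNReal.ofReal_add (by positivity) (by positivity)]
  refine ENNReal.ofReal_le_ofReal ?_
  rw [final_add, inner_add_right]
  exact norm_add_sq_le_weighted hc _ _

theorem overlap_sum_le {J : Type} (P : LOCC α' β' n α β) (Ψ : Sys (α' × β')) (s : Finset J)
    (Φ : J → Sys (α × β)) :
    P.overlap Ψ (∑ j ∈ s, Φ j) ≤ s.card * ∑ j ∈ s, P.overlap Ψ (Φ j) := by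
  simp only [overlap]
  rw [← Summable.tsum_finsetSum (fun _ _ => ENNReal.summable), ← ENNReal.tsum_mul_left]
  refine ENNReal.tsum_le_tsum fun ω => ?_
  rw [← ENNReal.ofReal_sum_of_nonneg (fun _ _ => by positivity),
    ← ENNReal.ofReal_natCast, ← ENNReal.ofReal_mul (by positivity)]
  refine ENNReal.ofReal_le_ofReal ?_
  rw [final_sum, inner_sum]
  calc _ ≤ (∑ j ∈ s, ‖inner ℂ Ψ (P.final (Φ j) ω)‖) ^ 2 := by
        gcongr; exact norm_sum_le _ _
    _ ≤ _ := sq_sum_le_card_mul_sum_sq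

end LOCC

theorem DFLEC.fidelity_eq_overlap (D : DFLEC α β) (Φ : Sys (α × β)) :
    D.fidelity Φ = D.op.overlap D.target Φ := by
  have h := D.op.hasSum_norm_inner_sq_output Φ Set.univ D.target
  rw [DFLEC.fidelity, ← h.tsum_eq,
    ENNReal.ofReal_tsum_of_nonneg (fun _ => by positivity) h.summable, LOCC.overlap]
  exact tsum_univ fun ω => ENNReal.ofReal (‖inner ℂ D.target (D.op.final Φ ω)‖ ^ 2)

theorem DFLEC.fidelity_le_one (D : DFLEC α β) {Φ : Sys (α × β)} (hΦ : ‖Φ‖ = 1) :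
    D.fidelity Φ ≤ 1 := by
  rw [D.fidelity_eq_overlap]
  simpa [hΦ] using D.op.overlap_le_norm_sq D.target_spec.norm_eq_one Φ

theorem PFLEC.succProb_add_failProb {Φ : Sys (α × β)} (I : PFLEC Φ) (hΦ : ‖Φ‖ = 1) :
    I.succProb + I.failProb = 1 := by
  have h := I.op.tsum_final Φ
  rw [hΦ] at h
  rw [PFLEC.succProb, PFLEC.failProb, LOCC.prob, LOCC.prob]
  exact (ENNReal.summable.tsum_add_tsum_compl (s := I.success)
    (f := fun ω => ENNReal.ofReal (‖I.op.final Φ ω‖ ^ 2)) ENNReal.summable).trans (by simpa using h)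

theorem PFLEC.final_eq_smul {Φ : Sys (α × β)} (I : PFLEC Φ) {ω : I.op.Record}
    (hω : ω ∈ I.success) : I.op.final Φ ω = inner ℂ I.target (I.op.final Φ ω) • I.target := by
  set φ := I.op.final Φ ω
  set y := φ - inner ℂ I.target φ • I.target with hy
  have htarget : inner ℂ I.target y = 0 := by
    rw [hy, inner_sub_right, inner_smul_right, inner_self_eq_norm_sq_to_K,
      I.target_spec.norm_eq_one]
    simp
  have houtput := I.op.hasSum_norm_inner_sq_output Φ I.success y
  rw [I.output_eq, _root_.smul_apply, ketbra_apply, htarget, zero_smul, smul_zero,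
    inner_zero_right, Complex.zero_re, hasSum_zero_iff_of_nonneg fun _ => sq_nonneg _] at houtput
  have hfinal : inner ℂ y φ = 0 := by simpa using congrFun houtput ⟨ω, hω⟩
  have hself : inner ℂ y y = 0 := by
    nth_rewrite 2 [hy]
    rw [inner_sub_right, hfinal, inner_smul_right, inner_eq_zero_symm.mp htarget, mul_zero,
      sub_zero]
  exact sub_eq_zero.mp (inner_self_eq_zero.mp hself)

theorem PFLEC.norm_final {Φ : Sys (α × β)} (I : PFLEC Φ) {ω : I.op.Record}
    (hω : ω ∈ I.success) : ‖I.op.final Φ ω‖ = ‖inner ℂ I.target (I.op.final Φ ω)‖ := by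
  conv_lhs => rw [I.final_eq_smul hω, norm_smul, I.target_spec.norm_eq_one, mul_one]

/-- A probabilistic concentration, seen as a deterministic one. -/
def PFLEC.toDFLEC {Φ : Sys (α × β)} (I : PFLEC Φ) : DFLEC α β :=
  ⟨I.outA, I.outB, I.rounds, I.op, I.size, I.target, I.target_spec⟩

theorem PFLEC.succProb_le_fidelity {Φ : Sys (α × β)} (I : PFLEC Φ) :
    I.succProb ≤ I.toDFLEC.fidelity Φ := by
  rw [DFLEC.fidelity_eq_overlap, PFLEC.succProb, LOCC.prob]
  refine le_trans (le_of_eq (tsum_congr fun ω => congrArg (fun x => ENNReal.ofReal (x ^ 2))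
    (I.norm_final ω.2))) (ENNReal.tsum_comp_le_tsum_of_injective Subtype.val_injective
      fun ω => ENNReal.ofReal (‖inner ℂ I.target (I.op.final Φ ω)‖ ^ 2))

section Head

variable (Φ : Sys (α × β))

/-- The component of `Φ` along a finite set of eigenvectors of its reduced density. -/
def head (s : Finset (EigenIndex Φ)) : Sys (α × β) :=
  ∑ i ∈ s, tens (eigenvec Φ i) (contr (eigenvec Φ i) Φ)

theorem inner_contr_eigenvec [DecidableEq (EigenIndex Φ)] (i j : EigenIndex Φ) :
    inner ℂ (contr (eigenvec Φ i) Φ) (contr (eigenvec Φ j) Φ) =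
      if i = j then (eigenval Φ i : ℂ) else 0 := by
  rw [inner_contr_contr, reduced_eigenvec, inner_smul_right,
    orthonormal_iff_ite.mp (orthonormal_eigenvec Φ), mul_ite, mul_one, mul_zero]
  simp only [eq_comm]

theorem norm_contr_eigenvec_sq (i : EigenIndex Φ) :
    ‖contr (eigenvec Φ i) Φ‖ ^ 2 = eigenval Φ i := by
  classical
  rw [← inner_self_eq_norm_sq (𝕜 := ℂ), inner_contr_eigenvec, if_pos rfl]
  rfl

variable (s : Finset (EigenIndex Φ))

theorem schmidtRankLE_head : SchmidtRankLE (head Φ s) s.card := SchmidtRankLE.sum_tens s _ _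

theorem norm_head_sq : ‖head Φ s‖ ^ 2 = ∑ i ∈ s, eigenval Φ i := by
  have h := norm_sq_sum_tens
    ((orthonormal_eigenvec Φ).comp ((↑) : s → EigenIndex Φ) Subtype.val_injective)
    (fun i => contr (eigenvec Φ i) Φ)
  simp only [Function.comp_apply, norm_contr_eigenvec_sq] at h
  rwa [Finset.sum_coe_sort s fun i => tens (eigenvec Φ i) (contr (eigenvec Φ i) Φ),
    Finset.sum_coe_sort s (eigenval Φ)] at h

theorem norm_sub_head_sq : ‖Φ - head Φ s‖ ^ 2 = ‖Φ‖ ^ 2 - ∑ i ∈ s, eigenval Φ i := by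
  have hinner : RCLike.re (inner ℂ Φ (head Φ s)) = ∑ i ∈ s, eigenval Φ i := by
    rw [inner_re_symm, head, sum_inner, map_sum]
    exact Finset.sum_congr rfl fun i _ => by
      rw [inner_tens_left, inner_self_eq_norm_sq, norm_contr_eigenvec_sq]
  rw [@norm_sub_sq ℂ, hinner, norm_head_sq]
  ring

variable {Φ}

theorem DFLEC.overlap_head_le (D : DFLEC α β) :
    D.op.overlap D.target (head Φ s) ≤
      ENNReal.ofReal (s.card / D.size * ∑ i ∈ s, eigenval Φ i) := by
  rw [← norm_head_sq]
  exact D.op.overlap_le_of_schmidtRankLE D.target_spec (schmidtRankLE_head Φ s)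

theorem DFLEC.overlap_sub_head_le (D : DFLEC α β) :
    D.op.overlap D.target (Φ - head Φ s) ≤
      ENNReal.ofReal (‖Φ‖ ^ 2 - ∑ i ∈ s, eigenval Φ i) := by
  rw [← norm_sub_head_sq]
  exact D.op.overlap_le_norm_sq D.target_spec.norm_eq_one _

theorem DFLEC.fidelity_le_head_add_tail (D : DFLEC α β) {c : ℝ} (hc : 0 < c) :
    D.fidelity Φ ≤ ENNReal.ofReal ((1 + 1 / c) * (s.card / D.size * ∑ i ∈ s, eigenval Φ i) +
      (1 + c) * (‖Φ‖ ^ 2 - ∑ i ∈ s, eigenval Φ i)) := by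
  have hhead : 0 ≤ ∑ i ∈ s, eigenval Φ i := Finset.sum_nonneg fun i _ => (eigenval_pos Φ i).le
  have htail : 0 ≤ ‖Φ‖ ^ 2 - ∑ i ∈ s, eigenval Φ i := by
    rw [← norm_sub_head_sq]
    positivity
  rw [ENNReal.ofReal_add (by positivity) (by positivity),
    ENNReal.ofReal_mul (by positivity : 0 ≤ 1 + 1 / c),
    ENNReal.ofReal_mul (by positivity : 0 ≤ 1 + c)]
  calc D.fidelity Φ = D.op.overlap D.target (head Φ s + (Φ - head Φ s)) := by
        rw [add_sub_cancel, D.fidelity_eq_overlap]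
    _ ≤ ENNReal.ofReal (1 + 1 / c) * D.op.overlap D.target (head Φ s) +
        ENNReal.ofReal (1 + c) * D.op.overlap D.target (Φ - head Φ s) :=
        D.op.overlap_add_le _ _ _ hc
    _ ≤ _ := by
        gcongr
        · exact D.overlap_head_le s
        · exact D.overlap_sub_head_le s

theorem DFLEC.fidelity_le_sum_blocks (D : DFLEC α β) {J : Type} (t : Finset J)
    {s : J → Finset (EigenIndex Φ)} (hs : (t : Set J).PairwiseDisjoint s) :
    D.fidelity Φ ≤ ENNReal.ofReal
      ((t.card + 1) * (∑ j ∈ t, ((s j).card / D.size * ∑ i ∈ s j, eigenval Φ i) +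
        (‖Φ‖ ^ 2 - ∑ j ∈ t, ∑ i ∈ s j, eigenval Φ i))) := by
  classical
  let χ : Option J → Sys (α × β) :=
    fun o => o.elim (Φ - head Φ (t.biUnion s)) fun j => head Φ (s j)
  have hχ : ∑ o ∈ t.insertNone, χ o = Φ := by
    rw [Finset.sum_insertNone]
    exact (congrArg _ (Finset.sum_biUnion hs).symm).trans (sub_add_cancel _ _)
  have hblock : ∀ j ∈ t, 0 ≤ ((s j).card / D.size * ∑ i ∈ s j, eigenval Φ i : ℝ) :=
    fun j _ => by rw [← norm_head_sq]; positivity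
  have htail : 0 ≤ ‖Φ‖ ^ 2 - ∑ j ∈ t, ∑ i ∈ s j, eigenval Φ i := by
    rw [← Finset.sum_biUnion hs, ← norm_sub_head_sq]
    positivity
  calc D.fidelity Φ = D.op.overlap D.target (∑ o ∈ t.insertNone, χ o) := by
        rw [hχ, D.fidelity_eq_overlap]
    _ ≤ (t.card + 1 : ℕ) * ∑ o ∈ t.insertNone, D.op.overlap D.target (χ o) := by
        simpa only [Finset.card_insertNone] using
          D.op.overlap_sum_le D.target t.insertNone χ
    _ ≤ (t.card + 1 : ℕ) * (ENNReal.ofReal (‖Φ‖ ^ 2 - ∑ j ∈ t, ∑ i ∈ s j, eigenval Φ i) +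
        ∑ j ∈ t, ENNReal.ofReal ((s j).card / D.size * ∑ i ∈ s j, eigenval Φ i)) := by
        rw [Finset.sum_insertNone]
        gcongr with j
        · rw [← Finset.sum_biUnion hs]
          exact D.overlap_sub_head_le _
        · exact D.overlap_head_le (s j)
    _ = _ := by
        rw [add_comm (ENNReal.ofReal _), ← ENNReal.ofReal_sum_of_nonneg hblock,
          ← ENNReal.ofReal_add (Finset.sum_nonneg hblock) htail, ← ENNReal.ofReal_natCast,
          ← ENNReal.ofReal_mul (Nat.cast_nonneg _), Nat.cast_add_one]

theorem PFLEC.succProb_mul_le (I : PFLEC Φ) :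
    I.succProb * ENNReal.ofReal (1 - s.card / I.size) ≤
      ENNReal.ofReal (‖Φ‖ ^ 2 - ∑ i ∈ s, eigenval Φ i) := by
  rw [← norm_sub_head_sq, ← I.op.tsum_final, PFLEC.succProb, LOCC.prob, ← ENNReal.tsum_mul_right]
  refine le_trans (ENNReal.tsum_le_tsum fun ω => ?_)
    (ENNReal.tsum_comp_le_tsum_of_injective Subtype.val_injective
      fun ω => ENNReal.ofReal (‖I.op.final (Φ - head Φ s) ω‖ ^ 2))
  rw [← ENNReal.ofReal_mul (by positivity)]
  refine ENNReal.ofReal_le_ofReal ?_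
  have hsub : I.op.final (Φ - head Φ s) ω = I.op.final Φ ω - I.op.final (head Φ s) ω := by
    rw [eq_sub_iff_add_eq, ← LOCC.final_add, sub_add_cancel]
  have h := I.target_spec.le_norm_smul_sub_sq
    (I.op.schmidtRankLE_final (schmidtRankLE_head Φ s) ω) (inner ℂ I.target (I.op.final Φ ω))
  rwa [← I.final_eq_smul ω.2, ← I.norm_final ω.2, ← hsub] at h

end Head

end Converse

section Mixture

variable {ι : Type*} [Fintype ι]

theorem card_mul_div_card_of_sum_eq {s : Finset ι} {w : ι → ℝ} (h0 : ∀ i, 0 ≤ w i)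
    (hw : ∑ i, w i = s.card) (i : ι) : s.card * (w i / s.card) = w i :=
  mul_div_cancel_of_imp' fun hs =>
    (Finset.sum_eq_zero_iff_of_nonneg fun i _ => h0 i).mp (hw.trans hs) i (Finset.mem_univ i)

variable [DecidableEq ι]

theorem of_ite_mem_doublyStochastic {s : Finset ι} {w : ι → ℝ} (h0 : ∀ i, 0 ≤ w i)
    (h1 : ∀ i, w i ≤ 1) (hw : ∑ i, w i = s.card) :
    (Matrix.of fun r i => if r ∈ s then w i / s.card else (1 - w i) / sᶜ.card) ∈
      doublyStochastic ℝ ι := by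
  have h1' : ∀ i, 0 ≤ 1 - w i := fun i => sub_nonneg.mpr (h1 i)
  have hw' : ∑ i, (1 - w i) = sᶜ.card := by
    simp [hw, Finset.card_compl, Nat.cast_sub s.card_le_univ]
  rw [mem_doublyStochastic_iff_sum]
  refine ⟨fun r i => ?_, fun r => ?_, fun i => ?_⟩ <;> simp only [Matrix.of_apply]
  · have := h0 i
    have := h1' i
    split_ifs <;> positivity
  · split_ifs with hr
    · have : s.card ≠ 0 := Finset.card_ne_zero_of_mem hr
      rw [← Finset.sum_div, hw, div_self (mod_cast this)]
    · have : sᶜ.card ≠ 0 := Finset.card_ne_zero_of_mem (Finset.mem_compl.mpr hr)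
      rw [← Finset.sum_div, hw', div_self (mod_cast this)]
  · rw [Finset.sum_ite, Finset.sum_const, Finset.sum_const, Finset.filter_univ_mem,
      Finset.filter_notMem_eq_sdiff, ← Finset.compl_eq_univ_sdiff, nsmul_eq_mul, nsmul_eq_mul,
      card_mul_div_card_of_sum_eq h0 hw, card_mul_div_card_of_sum_eq h1' hw', add_sub_cancel]

theorem sum_perm_mul_apply {D : Matrix ι ι ℝ} {t : Equiv.Perm ι → ℝ}
    (ht : ∑ σ, t σ • σ.permMatrix ℝ = D) (g : ι → ℝ) (l : ι) :
    ∑ σ, t σ * g (σ l) = ∑ i, D l i * g i := by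
  change _ = (D.mulVec g) l
  simp [← ht, Matrix.sum_mulVec, Matrix.smul_mulVec, Matrix.permMatrix_mulVec]

theorem exists_perm_mixture {s : Finset ι} {w : ι → ℝ} (h0 : ∀ i, 0 ≤ w i)
    (h1 : ∀ i, w i ≤ 1) (hw : ∑ i, w i = s.card) :
    ∃ t : Equiv.Perm ι → ℝ, (∀ σ, 0 ≤ t σ) ∧ ∑ σ, t σ = 1 ∧
      ∀ g : ι → ℝ, ∑ σ, t σ * ∑ l ∈ s, g (σ l) = ∑ i, w i * g i := by
  obtain ⟨t, ht0, ht1, ht⟩ :=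
    exists_eq_sum_perm_of_mem_doublyStochastic (of_ite_mem_doublyStochastic h0 h1 hw)
  refine ⟨t, ht0, ht1, fun g => ?_⟩
  calc ∑ σ, t σ * ∑ l ∈ s, g (σ l) = ∑ _ ∈ s, ∑ i, w i / s.card * g i := by
        simp_rw [Finset.mul_sum]
        rw [Finset.sum_comm]
        refine Finset.sum_congr rfl fun l hl => ?_
        simpa only [Matrix.of_apply, if_pos hl] using sum_perm_mul_apply ht g l
    _ = ∑ i, w i * g i := by
        rw [Finset.sum_const, nsmul_eq_mul, Finset.mul_sum]
        refine Finset.sum_congr rfl fun i _ => ?_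
        rw [← mul_assoc, card_mul_div_card_of_sum_eq h0 hw]

omit [DecidableEq ι] in
theorem exists_embedding_mixture {M : ℕ} {w : ι → ℝ} (h0 : ∀ i, 0 ≤ w i)
    (h1 : ∀ i, w i ≤ 1) (hw : ∑ i, w i = M) :
    ∃ t : (Fin M ↪ ι) → ℝ, (∀ τ, 0 ≤ t τ) ∧ ∑ τ, t τ = 1 ∧
      ∀ g : ι → ℝ, ∑ τ, t τ * ∑ l, g (τ l) = ∑ i, w i * g i := by
  classical
  have hM : Fintype.card (Fin M) ≤ Fintype.card ι := by
    have h : ∑ i, w i ≤ ∑ _i : ι, 1 := Finset.sum_le_sum fun i _ => h1 i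
    rw [hw] at h
    simpa using h
  obtain ⟨r⟩ := Function.Embedding.nonempty_of_card_le hM
  obtain ⟨t, ht0, ht1, ht⟩ := exists_perm_mixture (s := Finset.univ.map r) h0 h1 (by simpa using hw)
  let τ : Equiv.Perm ι → (Fin M ↪ ι) := fun σ => r.trans σ.toEmbedding
  have hpush : ∀ F : (Fin M ↪ ι) → ℝ,
      ∑ τ', (∑ σ with τ σ = τ', t σ) * F τ' = ∑ σ, t σ * F (τ σ) := fun F => by
    rw [← Finset.sum_fiberwise Finset.univ τ]
    refine Finset.sum_congr rfl fun τ' _ => ?_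
    rw [Finset.sum_mul]
    exact Finset.sum_congr rfl fun σ hσ => by rw [(Finset.mem_filter.mp hσ).2]
  refine ⟨fun τ' => ∑ σ with τ σ = τ', t σ, fun τ' => Finset.sum_nonneg fun σ _ => ht0 σ, ?_,
    fun g => ?_⟩
  · rw [Finset.sum_fiberwise, ht1]
  · rw [hpush fun τ' => ∑ l, g (τ' l), ← ht g]
    simp [τ]

end Mixture

section Direct

variable {α β : Type}

/-- The standard basis vectors of `Sys ℕ`. -/
def bas (k : ℕ) : Sys ℕ := lp.single 2 k 1

theorem inner_bas (k l : ℕ) : inner ℂ (bas k) (bas l) = if k = l then (1 : ℂ) else 0 := by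
  rw [bas, bas, lp.inner_single_left, lp.single_apply]
  by_cases h : k = l
  · subst h; simp
  · simp [h]

theorem orthonormal_bas : Orthonormal ℂ bas := orthonormal_iff_ite.mpr inner_bas

theorem orthonormal_bas_fin (M : ℕ) : Orthonormal ℂ fun l : Fin M => bas l :=
  orthonormal_bas.comp _ Fin.val_injective

/-- The standard maximally entangled state of size `M`. -/
def mes (M : ℕ) : Sys (ℕ × ℕ) := (((Real.sqrt M)⁻¹ : ℝ) : ℂ) • ∑ l : Fin M, tens (bas l) (bas l)

theorem isMaxEntangled_mes {M : ℕ} (hM : 0 < M) : IsMaxEntangled (mes M) M := by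
  refine ⟨hM, fun l => bas l, fun l => bas l, orthonormal_bas_fin M, orthonormal_bas_fin M,
    fun a b => ?_⟩
  rw [mes, lp.coeFn_smul, Pi.smul_apply, lp.coeFn_sum, Finset.sum_apply]
  simp

theorem inner_sum_tens_bas {M L : ℕ} (hL : M ≤ L) :
    inner ℂ (∑ l : Fin L, tens (bas l) (bas l)) (∑ l : Fin M, tens (bas l) (bas l)) = (M : ℂ) := by
  have hterm : ∀ l : Fin M, inner ℂ (∑ k : Fin L, tens (bas k) (bas k)) (tens (bas l) (bas l)) =
      (1 : ℂ) := fun l => by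
    rw [sum_inner, Finset.sum_eq_single (Fin.castLE hL l)]
    · rw [inner_tens_tens, inner_bas, Fin.val_castLE, if_pos rfl, mul_one]
    · intro k _ hk
      have hkl : (k : ℕ) ≠ l := fun h => hk (Fin.ext h)
      rw [inner_tens_tens, inner_bas, if_neg hkl, zero_mul]
    · simp
  rw [inner_sum, Finset.sum_congr rfl fun l _ => hterm l]
  simp

theorem norm_inner_mes_sq {M L : ℕ} (hM : 0 < M) (hL : M ≤ L) :
    ‖inner ℂ (mes L) (mes M)‖ ^ 2 = M / L := by
  have hM' : (0 : ℝ) < M := mod_cast hM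
  have hL' : (0 : ℝ) < L := mod_cast hM.trans_le hL
  rw [mes, mes, inner_smul_left, inner_smul_right, inner_sum_tens_bas hL, norm_mul, norm_mul,
    RCLike.norm_conj, Complex.norm_real, Complex.norm_real, Complex.norm_natCast,
    Real.norm_of_nonneg (by positivity), Real.norm_of_nonneg (by positivity), mul_pow, mul_pow,
    inv_pow, inv_pow, Real.sq_sqrt hL'.le, Real.sq_sqrt hM'.le]
  field_simp

/-- The operator `∑ l, c l |l⟩⟨u l|`. -/
def relabel {M : ℕ} (u : Fin M → Sys α) (c : Fin M → ℝ) : Sys α →L[ℂ] Sys ℕ :=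
  ∑ l, (c l : ℂ) • InnerProductSpace.rankOne ℂ (bas l) (u l)

theorem smul_tens (c : ℂ) (u : Sys α) (v : Sys β) : c • tens u v = tens (c • u) v := by
  ext p
  simp [mul_assoc]

section Relabel

variable {M : ℕ}

theorem relabel_apply (u : Fin M → Sys α) (c : Fin M → ℝ) (x : Sys α) :
    relabel u c x = ∑ l, ((c l : ℂ) * inner ℂ (u l) x) • bas l := by
  simp only [relabel, _root_.sum_apply, _root_.smul_apply, InnerProductSpace.rankOne_apply,
    smul_smul]

theorem norm_relabel_sq (u : Fin M → Sys α) (c : Fin M → ℝ) (x : Sys α) :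
    ‖relabel u c x‖ ^ 2 = ∑ l, c l ^ 2 * ‖inner ℂ (u l) x‖ ^ 2 := by
  rw [relabel_apply, ← inner_self_eq_norm_sq (𝕜 := ℂ),
    (orthonormal_bas_fin M).inner_sum, map_sum]
  refine Finset.sum_congr rfl fun l _ => ?_
  rw [RCLike.conj_mul, ← RCLike.ofReal_pow, RCLike.ofReal_re, norm_mul, mul_pow,
    Complex.norm_real, Real.norm_eq_abs, sq_abs]

theorem relabel_one_apply {u : Fin M → Sys α} (hu : Orthonormal ℂ u) (l : Fin M) :
    relabel u (fun _ => 1) (u l) = bas l := by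
  rw [relabel_apply, Finset.sum_eq_single l]
  · simp [inner_self_eq_norm_sq_to_K, hu.1 l]
  · intro k _ hk
    rw [hu.2 hk, mul_zero, zero_smul]
  · simp

theorem actA_relabel (u : Fin M → Sys α) (c : Fin M → ℝ) (Φ : Sys (α × β)) :
    actA (relabel u c) Φ = ∑ l : Fin M, tens (bas l) ((c l : ℂ) • contr (u l) Φ) := by
  ext p
  rw [actA_apply, relabel_apply, lp.coeFn_sum, lp.coeFn_sum, Finset.sum_apply, Finset.sum_apply]
  refine Finset.sum_congr rfl fun l _ => ?_
  simp only [lp.coeFn_smul, Pi.smul_apply, smul_eq_mul, tens_apply, contr_apply]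
  ring

theorem actB_relabel_actA_relabel {Φ : Sys (α × β)} {u : Fin M → Sys α} {v : Fin M → Sys β}
    (hv : Orthonormal ℂ v) {a c : Fin M → ℝ} {b : ℝ}
    (hcontr : ∀ l, contr (u l) Φ = (a l : ℂ) • v l) (hb : ∀ l, c l * a l = b) :
    actB (relabel v fun _ => 1) (actA (relabel u c) Φ) =
      (b : ℂ) • ∑ l : Fin M, tens (bas l) (bas l) := by
  rw [actA_relabel, actB_sum, Finset.smul_sum]
  refine Finset.sum_congr rfl fun l _ => ?_
  rw [hcontr, smul_smul, ← Complex.ofReal_mul, hb, actB_tens, map_smul, relabel_one_apply hv,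
    ← tens_smul_left, smul_tens]

end Relabel

section Discard

variable {ι : Type} [Fintype ι]

/-- The measurement outcomes that cover the orthogonal complement of an orthonormal system. -/
def discard (u : ι → Sys α) (a : α) : Sys α →L[ℂ] Sys ℕ :=
  ((lp.evalCLM ℂ (fun _ : α => ℂ) 2 a).smulRight (bas 0)).comp
    (ContinuousLinearMap.id ℂ _ - ∑ k, ketbra (u k))

theorem discard_apply (u : ι → Sys α) (a : α) (x : Sys α) :
    discard u a x = (x - ∑ k, inner ℂ (u k) x • u k : Sys α) a • bas 0 := by
  have hproj : (ContinuousLinearMap.id ℂ (Sys α) - ∑ k, ketbra (u k) : Sys α →L[ℂ] Sys α) x =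
      x - ∑ k, inner ℂ (u k) x • u k := by
    simp only [_root_.sub_apply, _root_.sum_apply, ketbra_apply, ContinuousLinearMap.id_apply]
  rw [discard, ContinuousLinearMap.comp_apply, hproj]
  rfl

theorem norm_sub_sum_inner_smul_sq {𝕜 E : Type*} [RCLike 𝕜] [NormedAddCommGroup E]
    [InnerProductSpace 𝕜 E] {u : ι → E} (hu : Orthonormal 𝕜 u) (x : E) :
    ‖x - ∑ k, inner 𝕜 (u k) x • u k‖ ^ 2 = ‖x‖ ^ 2 - ∑ k, ‖inner 𝕜 (u k) x‖ ^ 2 := by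
  have hproj : ‖∑ k, inner 𝕜 (u k) x • u k‖ ^ 2 = ∑ k, ‖inner 𝕜 (u k) x‖ ^ 2 := by
    rw [← inner_self_eq_norm_sq (𝕜 := 𝕜), hu.inner_sum, map_sum]
    refine Finset.sum_congr rfl fun l _ => ?_
    rw [RCLike.conj_mul, ← RCLike.ofReal_pow, RCLike.ofReal_re]
  have hinner : RCLike.re (inner 𝕜 x (∑ k, inner 𝕜 (u k) x • u k)) =
      ∑ k, ‖inner 𝕜 (u k) x‖ ^ 2 := by
    rw [inner_sum, map_sum]
    refine Finset.sum_congr rfl fun l _ => ?_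
    rw [inner_smul_right, inner_mul_symm_re_eq_norm, norm_mul, norm_inner_symm x, sq]
  rw [@norm_sub_sq 𝕜, hproj, hinner]
  ring

variable {u : ι → Sys α} (hu : Orthonormal ℂ u)
include hu

theorem hasSum_norm_discard_sq (x : Sys α) :
    HasSum (fun a => ‖discard u a x‖ ^ 2) (‖x‖ ^ 2 - ∑ k, ‖inner ℂ (u k) x‖ ^ 2) := by
  rw [← norm_sub_sum_inner_smul_sq hu, norm_sq_eq]
  refine (summable_sq _).hasSum.congr_fun fun a => ?_
  rw [discard_apply, norm_smul, orthonormal_bas.1, mul_one]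

theorem isMeasurement_sumElim {J : Type} [Fintype J] {K : J → Sys α →L[ℂ] Sys ℕ}
    (hK : ∀ x, ∑ j, ‖K j x‖ ^ 2 = ∑ k, ‖inner ℂ (u k) x‖ ^ 2) :
    IsMeasurement (Sum.elim K (discard u)) := by
  intro x
  have hleft : HasSum (fun j => ‖K j x‖ ^ 2) (∑ k, ‖inner ℂ (u k) x‖ ^ 2) :=
    hK x ▸ hasSum_fintype _
  simpa using HasSum.sum (f := fun j => ‖Sum.elim K (discard u) j x‖ ^ 2) hleft
    (hasSum_norm_discard_sq hu x)

theorem isMeasurement_mixture {M : ℕ} {w : ι → ℝ} (hw : ∀ i, 0 < w i)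
    {t : (Fin M ↪ ι) → ℝ} (ht : ∀ τ, 0 ≤ t τ)
    (htw : ∀ g : ι → ℝ, ∑ τ, t τ * ∑ l, g (τ l) = ∑ i, w i * g i) :
    IsMeasurement (Sum.elim
      (fun τ : Fin M ↪ ι => relabel (u ∘ τ) fun l => Real.sqrt (t τ / w (τ l))) (discard u)) := by
  refine isMeasurement_sumElim hu fun x => ?_
  calc _ = ∑ τ, t τ * ∑ l, ‖inner ℂ (u (τ l)) x‖ ^ 2 / w (τ l) := by
        refine Finset.sum_congr rfl fun τ _ => ?_
        rw [norm_relabel_sq, Finset.mul_sum]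
        refine Finset.sum_congr rfl fun l _ => ?_
        rw [Real.sq_sqrt (div_nonneg (ht τ) (hw _).le), Function.comp_apply]
        ring
    _ = ∑ k, w k * (‖inner ℂ (u k) x‖ ^ 2 / w k) := htw fun k => ‖inner ℂ (u k) x‖ ^ 2 / w k
    _ = _ := Finset.sum_congr rfl fun k _ => mul_div_cancel₀ _ (hw k).ne'

end Discard

theorem isMeasurement_relabel_discard {M : ℕ} {v : Fin M → Sys α} (hv : Orthonormal ℂ v) :
    IsMeasurement (Sum.elim (fun _ : Unit => relabel v fun _ => 1) (discard v)) :=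
  isMeasurement_sumElim hv fun x => by simp [norm_relabel_sq]

/-- The protocol in which the first party measures with `K` or discards its system, and the second
party, on the outcome `j`, relabels the orthonormal system `v j` or discards its own. -/
def twoStep {ι J : Type} [Fintype ι] {u : ι → Sys α} {K : J → Sys α →L[ℂ] Sys ℕ}
    (hK : IsMeasurement (Sum.elim K (discard u))) {M : ℕ} {v : J → Fin M → Sys β}
    (hv : ∀ j, Orthonormal ℂ (v j)) : LOCC ℕ ℕ 2 α β :=
  .alice _ hK (Sum.elim
    (fun j => .bob _ (isMeasurement_relabel_discard (hv j)) fun _ => .done)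
    (fun _ => .bob _ (isMeasurement_relabel_discard (v := (Fin.elim0 : Fin 0 → Sys β))
      ⟨fun l => l.elim0, fun l => l.elim0⟩) fun _ => .done))

section Schmidt

variable {ι : Type} {Φ : Sys (α × β)} {u : ι → Sys α} {v : ι → Sys β} {p : ι → ℝ}

theorem final_mixture (hv : Orthonormal ℂ v) (hp : ∀ i, 0 < p i)
    (hcontr : ∀ i, contr (u i) Φ = (Real.sqrt (p i) : ℂ) • v i) {M : ℕ} (hM : 0 < M)
    {m x : ℝ} (hm : 0 < m) (hx : 0 ≤ x) (τ : Fin M ↪ ι) :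
    actB (relabel (v ∘ τ) fun _ => 1)
      (actA (relabel (u ∘ τ) fun l => Real.sqrt (x / (M * p (τ l) / m))) Φ) =
      (Real.sqrt (x * m) : ℂ) • mes M := by
  have : (0 : ℝ) < M := mod_cast hM
  rw [actB_relabel_actA_relabel (u := u ∘ τ) (hv.comp τ τ.injective)
    (a := fun l => Real.sqrt (p (τ l))) (b := Real.sqrt (x * m) * (Real.sqrt M)⁻¹)
    (fun l => hcontr (τ l)) fun l => ?_, mes,
    smul_smul, Complex.ofReal_mul]
  have hpl := hp (τ l)
  rw [← Real.sqrt_mul (by positivity), ← Real.sqrt_inv, ← Real.sqrt_mul (by positivity)]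
  congr 1
  field_simp

theorem exists_protocol [Fintype ι] [Nonempty ι] (hu : Orthonormal ℂ u) (hv : Orthonormal ℂ v)
    (hp : ∀ i, 0 < p i) (hcontr : ∀ i, contr (u i) Φ = (Real.sqrt (p i) : ℂ) • v i) {M : ℕ}
    (hM : 0 < M) (hpM : ∀ i, M * p i ≤ ∑ k, p k) :
    ∃ (P : LOCC ℕ ℕ 2 α β) (S : Set P.Record), P.prob Φ S = ENNReal.ofReal (∑ k, p k) ∧
      ∀ ω ∈ S, ∃ c : ℂ, P.final Φ ω = c • mes M := by
  set m := ∑ k, p k with hm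
  have hm0 : 0 < m := Finset.sum_pos (fun k _ => hp k) Finset.univ_nonempty
  have hM' : (0 : ℝ) < M := mod_cast hM
  let w : ι → ℝ := fun i => M * p i / m
  have hw : ∀ i, 0 < w i := fun i => div_pos (mul_pos hM' (hp i)) hm0
  obtain ⟨t, ht0, ht1, ht⟩ := exists_embedding_mixture (M := M) (fun i => (hw i).le)
    (fun i => (div_le_one hm0).mpr (hpM i)) (by
      rw [← Finset.sum_div, ← Finset.mul_sum, ← hm, mul_div_cancel_right₀ _ hm0.ne'])
  let P : LOCC ℕ ℕ 2 α β :=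
    twoStep (isMeasurement_mixture hu hw ht0 ht) fun τ => hv.comp τ τ.injective
  let record : (Fin M ↪ ι) → P.Record := fun τ => ⟨Sum.inl τ, Sum.inl (), ()⟩
  have hrecord : Function.Injective record := fun _ _ h =>
    Sum.inl_injective (congrArg Sigma.fst h)
  have hfinal : ∀ τ, P.final Φ (record τ) = (Real.sqrt (t τ * m) : ℂ) • mes M := fun τ =>
    final_mixture hv hp hcontr hM hm0 (ht0 τ) τ
  have hnorm : ∀ τ, ‖P.final Φ (record τ)‖ ^ 2 = t τ * m := fun τ => by
    rw [hfinal, norm_smul, (isMaxEntangled_mes hM).norm_eq_one, mul_one, Complex.norm_real,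
      Real.norm_of_nonneg (by positivity), Real.sq_sqrt (mul_nonneg (ht0 τ) hm0.le)]
  refine ⟨P, Set.range record, ?_, ?_⟩
  · rw [LOCC.prob, tsum_range (fun ω => ENNReal.ofReal (‖P.final Φ ω‖ ^ 2)) hrecord,
      tsum_fintype]
    simp_rw [hnorm]
    rw [← ENNReal.ofReal_sum_of_nonneg fun τ _ => mul_nonneg (ht0 τ) hm0.le, ← Finset.sum_mul,
      ht1, one_mul]
  · rintro _ ⟨τ, rfl⟩
    exact ⟨_, hfinal τ⟩

end Schmidt

section Eigen

variable (Φ : Sys (α × β))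

/-- The Schmidt vectors of the second system. -/
def schmidtB (i : EigenIndex Φ) : Sys β :=
  (((Real.sqrt (eigenval Φ i))⁻¹ : ℝ) : ℂ) • contr (eigenvec Φ i) Φ

theorem contr_eigenvec (i : EigenIndex Φ) :
    contr (eigenvec Φ i) Φ = (Real.sqrt (eigenval Φ i) : ℂ) • schmidtB Φ i := by
  have hsqrt : Real.sqrt (eigenval Φ i) ≠ 0 := (Real.sqrt_pos.mpr (eigenval_pos Φ i)).ne'
  rw [schmidtB, smul_smul, ← Complex.ofReal_mul, mul_inv_cancel₀ hsqrt, Complex.ofReal_one,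
    one_smul]

theorem orthonormal_schmidtB : Orthonormal ℂ (schmidtB Φ) := by
  classical
  rw [orthonormal_iff_ite]
  intro i j
  rw [schmidtB, schmidtB, inner_smul_left, inner_smul_right, inner_contr_eigenvec]
  split_ifs with h
  · subst h
    rw [Complex.conj_ofReal, ← Complex.ofReal_mul, ← Complex.ofReal_mul, ← mul_assoc, ← mul_inv,
      Real.mul_self_sqrt (eigenval_pos Φ i).le, inv_mul_cancel₀ (eigenval_pos Φ i).ne',
      Complex.ofReal_one]
  · rw [mul_zero, mul_zero]

variable {Φ}

theorem exists_protocol_eigenvec {M : ℕ} (hM : 0 < M) {s : Finset (EigenIndex Φ)}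
    (hs : s.Nonempty) (hp : ∀ i ∈ s, M * eigenval Φ i ≤ ∑ k ∈ s, eigenval Φ k) :
    ∃ (P : LOCC ℕ ℕ 2 α β) (S : Set P.Record),
      P.prob Φ S = ENNReal.ofReal (∑ k ∈ s, eigenval Φ k) ∧
      ∀ ω ∈ S, ∃ c : ℂ, P.final Φ ω = c • mes M := by
  have := hs.to_subtype
  rw [← Finset.sum_coe_sort s (eigenval Φ)] at hp ⊢
  exact exists_protocol (ι := s) (u := fun i => eigenvec Φ i) (v := fun i => schmidtB Φ i)
    ((orthonormal_eigenvec Φ).comp _ Subtype.val_injective)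
    ((orthonormal_schmidtB Φ).comp _ Subtype.val_injective) (fun i => eigenval_pos Φ i)
    (fun i => contr_eigenvec Φ i) hM fun i => hp i i.2

end Eigen

theorem ketbra_smul (c : ℂ) (x : Sys α) : ketbra (c • x) = (‖c‖ ^ 2) • ketbra x := by
  ext1 y
  rw [ketbra_apply, _root_.smul_apply, ketbra_apply, inner_smul_left, smul_smul,
    mul_right_comm, RCLike.conj_mul, mul_smul]
  norm_cast

theorem LOCC.output_eq_of_forall_smul {n : ℕ} {α' β' : Type} (P : LOCC α' β' n α β)
    {Φ : Sys (α × β)} {S : Set P.Record} {Ψ : Sys (α' × β')} (hΨ : ‖Ψ‖ = 1)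
    (h : ∀ ω ∈ S, ∃ c : ℂ, P.final Φ ω = c • Ψ) :
    P.output Φ S = (P.prob Φ S).toReal • ketbra Ψ := by
  choose! c hc using h
  have hketbra : ∀ ω : S, ketbra (P.final Φ ω) = (‖P.final Φ ω‖ ^ 2) • ketbra Ψ := fun ω => by
    rw [hc ω ω.2, ketbra_smul, norm_smul, hΨ, mul_one]
  have hsummable : Summable fun ω : S => ‖P.final Φ ω‖ ^ 2 := by
    have hall := ENNReal.summable_toReal (f := fun ω => ENNReal.ofReal (‖P.final Φ ω‖ ^ 2))
      (by rw [P.tsum_final]; exact ENNReal.ofReal_ne_top)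
    exact (hall.subtype S).congr fun ω => ENNReal.toReal_ofReal (sq_nonneg _)
  rw [LOCC.output, tsum_congr hketbra, hsummable.tsum_smul_const, LOCC.prob,
    ← ENNReal.ofReal_tsum_of_nonneg (fun _ => by positivity) hsummable,
    ENNReal.toReal_ofReal (tsum_nonneg fun _ => by positivity)]

variable {Φ : Sys (α × β)}

theorem exists_pflec {M : ℕ} (hM : 0 < M) {s : Finset (EigenIndex Φ)} (hs : s.Nonempty)
    (hp : ∀ i ∈ s, M * eigenval Φ i ≤ ∑ k ∈ s, eigenval Φ k) :
    ∃ I : PFLEC Φ, I.size = M ∧ I.succProb = ENNReal.ofReal (∑ k ∈ s, eigenval Φ k) := by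
  obtain ⟨P, S, hprob, hfinal⟩ := exists_protocol_eigenvec hM hs hp
  exact ⟨⟨ℕ, ℕ, 2, P, S, M, mes M, isMaxEntangled_mes hM,
    P.output_eq_of_forall_smul (isMaxEntangled_mes hM).norm_eq_one hfinal⟩, rfl, hprob⟩

theorem exists_dflec {M L : ℕ} (hM : 0 < M) (hL : M ≤ L) {s : Finset (EigenIndex Φ)}
    (hs : s.Nonempty) (hp : ∀ i ∈ s, M * eigenval Φ i ≤ ∑ k ∈ s, eigenval Φ k) :
    ∃ D : DFLEC α β, D.size = L ∧
      ENNReal.ofReal (M / L * ∑ k ∈ s, eigenval Φ k) ≤ D.fidelity Φ := by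
  obtain ⟨P, S, hprob, hfinal⟩ := exists_protocol_eigenvec hM hs hp
  refine ⟨⟨ℕ, ℕ, 2, P, L, mes L, isMaxEntangled_mes (hM.trans_le hL)⟩, rfl, ?_⟩
  rw [DFLEC.fidelity_eq_overlap, ENNReal.ofReal_mul (by positivity), ← hprob, LOCC.prob,
    ← ENNReal.tsum_mul_left]
  refine le_trans (le_of_eq (tsum_congr fun ω => ?_))
    (ENNReal.tsum_comp_le_tsum_of_injective Subtype.val_injective
      fun ω => ENNReal.ofReal (‖inner ℂ (mes L) (P.final Φ ω)‖ ^ 2))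
  obtain ⟨c, hc⟩ := hfinal ω ω.2
  rw [← ENNReal.ofReal_mul (by positivity), hc, inner_smul_right, norm_smul, norm_mul,
    (isMaxEntangled_mes hM).norm_eq_one, mul_one, mul_pow, norm_inner_mes_sq hM hL, mul_comm]

theorem exists_pflec_size (Φ : Sys (α × β)) {M : ℕ} (hM : 0 < M) :
    ∃ I : PFLEC Φ, I.size = M := by
  have hK : IsMeasurement (Sum.elim (Empty.elim : Empty → Sys α →L[ℂ] Sys ℕ)
      (discard (Empty.elim : Empty → Sys α))) :=
    isMeasurement_sumElim ⟨fun j => j.elim, fun j => j.elim⟩ fun x => by simp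
  let P : LOCC ℕ ℕ 2 α β := twoStep hK (M := 0) (v := Empty.rec) fun j => j.elim
  exact ⟨⟨ℕ, ℕ, 2, P, ∅, M, mes M, isMaxEntangled_mes hM,
    P.output_eq_of_forall_smul (isMaxEntangled_mes hM).norm_eq_one (by simp)⟩, rfl⟩

end Direct

section SpectralMass

variable {α β : Type} (Φ : Sys (α × β))

theorem specMass_univ : specMass (reduced Φ) Set.univ = ENNReal.ofReal (‖Φ‖ ^ 2) := by
  simp only [specMass_eq_tsum_eigenval, Set.preimage_univ, Set.indicator_univ, tsum_eigenval]

theorem specMass_mono {S S' : Set ℝ} (h : S ⊆ S') :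
    specMass (reduced Φ) S ≤ specMass (reduced Φ) S' := by
  rw [specMass_eq_tsum_eigenval, specMass_eq_tsum_eigenval]
  exact ENNReal.tsum_le_tsum fun i =>
    Set.indicator_le_indicator_of_subset (Set.preimage_mono h) (fun _ => zero_le) i

theorem specMass_ne_top (S : Set ℝ) : specMass (reduced Φ) S ≠ ⊤ :=
  ne_top_of_le_ne_top (specMass_univ Φ ▸ ENNReal.ofReal_ne_top)
    (specMass_mono Φ (Set.subset_univ S))

theorem specMass_union {S S' : Set ℝ} (h : Disjoint S S') :
    specMass (reduced Φ) (S ∪ S') = specMass (reduced Φ) S + specMass (reduced Φ) S' := by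
  simp only [specMass_eq_tsum_eigenval, ← ENNReal.tsum_add, Set.preimage_union]
  exact tsum_congr fun i => by rw [Set.indicator_union_of_disjoint (h.preimage _)]

theorem toReal_specMass_union {S S' : Set ℝ} (h : Disjoint S S') :
    (specMass (reduced Φ) (S ∪ S')).toReal =
      (specMass (reduced Φ) S).toReal + (specMass (reduced Φ) S').toReal := by
  rw [specMass_union Φ h, ENNReal.toReal_add (specMass_ne_top Φ _) (specMass_ne_top Φ _)]

theorem sum_eigenval_le_toReal_specMass {S : Set ℝ} {s : Finset (EigenIndex Φ)}
    (hs : ∀ i ∈ s, eigenval Φ i ∈ S) :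
    ∑ i ∈ s, eigenval Φ i ≤ (specMass (reduced Φ) S).toReal := by
  rw [← ENNReal.ofReal_le_iff_le_toReal (specMass_ne_top Φ S), specMass_eq_tsum_eigenval,
    ENNReal.ofReal_sum_of_nonneg fun i _ => (eigenval_pos Φ i).le]
  refine le_trans (le_of_eq (Finset.sum_congr rfl fun i hi => ?_)) (ENNReal.sum_le_tsum s)
  exact (Set.indicator_of_mem (hs i hi) _).symm

theorem sum_eigenval_le (s : Finset (EigenIndex Φ)) : ∑ i ∈ s, eigenval Φ i ≤ ‖Φ‖ ^ 2 := by
  have h := sum_eigenval_le_toReal_specMass Φ (S := Set.univ) (s := s) fun _ _ => trivial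
  rwa [specMass_univ, ENNReal.toReal_ofReal (sq_nonneg _)] at h

theorem eigenval_le (i : EigenIndex Φ) : eigenval Φ i ≤ ‖Φ‖ ^ 2 := by
  simpa using sum_eigenval_le Φ {i}

theorem specMass_Iio_of_norm_sq_lt {y : ℝ} (hy : ‖Φ‖ ^ 2 < y) :
    specMass (reduced Φ) (Set.Iio y) = ENNReal.ofReal (‖Φ‖ ^ 2) := by
  rw [specMass_eq_tsum_eigenval, ← tsum_eigenval]
  exact tsum_congr fun i =>
    Set.indicator_of_mem (Set.mem_Iio.mpr ((eigenval_le Φ i).trans_lt hy)) _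

theorem exists_lt_sum_eigenval {S : Set ℝ} {t : ℝ} (ht : 0 ≤ t)
    (h : ENNReal.ofReal t < specMass (reduced Φ) S) :
    ∃ s : Finset (EigenIndex Φ), (∀ i ∈ s, eigenval Φ i ∈ S) ∧ t < ∑ i ∈ s, eigenval Φ i := by
  classical
  rw [specMass_eq_tsum_eigenval, ENNReal.tsum_eq_iSup_sum, lt_iSup_iff] at h
  obtain ⟨s, hs⟩ := h
  refine ⟨s.filter fun i => eigenval Φ i ∈ S, fun i hi => (Finset.mem_filter.mp hi).2, ?_⟩
  rw [← ENNReal.ofReal_lt_ofReal_iff_of_nonneg ht,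
    ENNReal.ofReal_sum_of_nonneg fun i _ => (eigenval_pos Φ i).le, Finset.sum_filter]
  exact hs.trans_eq (Finset.sum_congr rfl fun i _ => by simp [Set.indicator])

theorem card_mul_le_sum_eigenval {x : ℝ} {s : Finset (EigenIndex Φ)}
    (hs : ∀ i ∈ s, x ≤ eigenval Φ i) : s.card * x ≤ ∑ i ∈ s, eigenval Φ i := by
  rw [← nsmul_eq_mul]
  exact Finset.card_nsmul_le_sum s _ _ hs

theorem finite_preimage_eigenval {x : ℝ} (hx : 0 < x) {S : Set ℝ} (hS : S ⊆ Set.Ici x) :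
    (eigenval Φ ⁻¹' S).Finite := by
  by_contra hinf
  obtain ⟨k, hk⟩ := exists_nat_gt (‖Φ‖ ^ 2 / x)
  obtain ⟨s, hs, hcard⟩ := Set.Infinite.exists_subset_card_eq hinf k
  have hle := (card_mul_le_sum_eigenval Φ fun i hi => hS (hs hi)).trans (sum_eigenval_le Φ s)
  rw [hcard, ← le_div_iff₀ hx] at hle
  exact hle.not_gt hk

theorem sum_eigenval_toFinset {S : Set ℝ} (hS : (eigenval Φ ⁻¹' S).Finite) :
    ∑ i ∈ hS.toFinset, eigenval Φ i = (specMass (reduced Φ) S).toReal := by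
  rw [specMass_eq_tsum_eigenval, tsum_eq_sum (s := hS.toFinset) fun i hi =>
    Set.indicator_of_notMem (fun h => hi (hS.mem_toFinset.mpr h)) _,
    ENNReal.toReal_sum fun i _ => by simp [Set.indicator, apply_ite (· ≠ ⊤)]]
  refine Finset.sum_congr rfl fun i hi => ?_
  rw [Set.indicator_of_mem (hS.mem_toFinset.mp hi), ENNReal.toReal_ofReal (eigenval_pos Φ i).le]

end SpectralMass

section Grid

variable {α β : Type} (Φ : Sys (α × β)) {y : ℕ → ℝ} (hpos : ∀ j, 0 < y j)

/-- The indices of the eigenvalues in `[y (j + 1), y j)`. Cutting the spectrum into such blocks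
turns one-shot estimates for a single block into estimates that only involve the masses of the
lower tails `{ρ < y j}`. -/
def gridBlock (j : ℕ) : Finset (EigenIndex Φ) :=
  (finite_preimage_eigenval Φ (hpos (j + 1))
    (Set.Ico_subset_Ici_self : Set.Ico (y (j + 1)) (y j) ⊆ _)).toFinset

theorem mem_gridBlock {j : ℕ} {i : EigenIndex Φ} :
    i ∈ gridBlock Φ hpos j ↔ eigenval Φ i ∈ Set.Ico (y (j + 1)) (y j) := by
  simp only [gridBlock, Set.Finite.mem_toFinset, Set.mem_preimage]

theorem pairwise_disjoint_gridBlock (hy : Antitone y) :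
    Pairwise (Function.onFun Disjoint (gridBlock Φ hpos)) := fun _ _ hij =>
  Finset.disjoint_left.mpr fun _ hi hj =>
    Set.disjoint_left.mp (hy.pairwise_disjoint_on_Ico_succ hij) ((mem_gridBlock Φ hpos).mp hi)
      ((mem_gridBlock Φ hpos).mp hj)

theorem sum_gridBlock (j : ℕ) :
    ∑ i ∈ gridBlock Φ hpos j, eigenval Φ i =
      (specMass (reduced Φ) (Set.Ico (y (j + 1)) (y j))).toReal :=
  sum_eigenval_toFinset Φ _

theorem sum_gridBlock_le (j : ℕ) :
    ∑ i ∈ gridBlock Φ hpos j, eigenval Φ i ≤ (specMass (reduced Φ) (Set.Iio (y j))).toReal :=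
  sum_eigenval_le_toReal_specMass Φ fun _ hi => ((mem_gridBlock Φ hpos).mp hi).2

theorem card_gridBlock_le (j : ℕ) :
    ((gridBlock Φ hpos j).card : ℝ) ≤ (specMass (reduced Φ) (Set.Iio (y j))).toReal / y (j + 1) :=
  (le_div_iff₀ (hpos _)).mpr <|
    (card_mul_le_sum_eigenval Φ fun _ hi => ((mem_gridBlock Φ hpos).mp hi).1).trans
      (sum_gridBlock_le Φ hpos j)

theorem norm_sq_sub_sum_gridBlock (hy : Antitone y) (hy0 : ‖Φ‖ ^ 2 < y 0) (N : ℕ) :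
    ‖Φ‖ ^ 2 - ∑ j ∈ Finset.range N, ∑ i ∈ gridBlock Φ hpos j, eigenval Φ i =
      (specMass (reduced Φ) (Set.Iio (y N))).toReal := by
  induction N with
  | zero => simp [specMass_Iio_of_norm_sq_lt Φ hy0]
  | succ N ih =>
    have hdisj : Disjoint (Set.Iio (y (N + 1))) (Set.Ico (y (N + 1)) (y N)) :=
      Set.disjoint_left.mpr fun z hz hz' => hz.not_ge hz'.1
    rw [← Set.Iio_union_Ico_eq_Iio (hy N.le_succ), toReal_specMass_union Φ hdisj,
      ← sum_gridBlock Φ hpos] at ih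
    rw [Finset.sum_range_succ]
    linarith

variable {Φ}
include hpos

theorem fidelity_le_grid (D : DFLEC α β) (hy : Antitone y) (hy0 : ‖Φ‖ ^ 2 < y 0) (N : ℕ) :
    D.fidelity Φ ≤ ENNReal.ofReal ((N + 1) * (∑ j ∈ Finset.range N,
      (specMass (reduced Φ) (Set.Iio (y j))).toReal ^ 2 / (y (j + 1) * D.size) +
        (specMass (reduced Φ) (Set.Iio (y N))).toReal)) := by
  have hblocks := D.fidelity_le_sum_blocks (Finset.range N) (s := gridBlock Φ hpos)
    ((pairwise_disjoint_gridBlock Φ hpos hy).set_pairwise _)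
  rw [norm_sq_sub_sum_gridBlock Φ hpos hy hy0, Finset.card_range] at hblocks
  refine hblocks.trans (ENNReal.ofReal_le_ofReal ?_)
  gcongr with j
  have hsum := Finset.sum_nonneg fun i (_ : i ∈ gridBlock Φ hpos j) => (eigenval_pos Φ i).le
  have hyj := hpos (j + 1)
  calc _ ≤ (specMass (reduced Φ) (Set.Iio (y j))).toReal / y (j + 1) / D.size *
        (specMass (reduced Φ) (Set.Iio (y j))).toReal := by
        gcongr
        · exact card_gridBlock_le Φ hpos j
        · exact sum_gridBlock_le Φ hpos j
    _ = _ := by rw [div_div]; ring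

theorem succProb_mul_le_grid (I : PFLEC Φ) (hy : Antitone y) (hy0 : ‖Φ‖ ^ 2 < y 0) (N : ℕ) :
    I.succProb * ENNReal.ofReal (1 - (∑ j ∈ Finset.range N,
      (specMass (reduced Φ) (Set.Iio (y j))).toReal / y (j + 1)) / I.size) ≤
        specMass (reduced Φ) (Set.Iio (y N)) := by
  classical
  let s := (Finset.range N).biUnion (gridBlock Φ hpos)
  have hsum : ∑ i ∈ s, eigenval Φ i =
      ∑ j ∈ Finset.range N, ∑ i ∈ gridBlock Φ hpos j, eigenval Φ i :=
    Finset.sum_biUnion ((pairwise_disjoint_gridBlock Φ hpos hy).set_pairwise _)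
  have hcard : (s.card : ℝ) ≤
      ∑ j ∈ Finset.range N, (specMass (reduced Φ) (Set.Iio (y j))).toReal / y (j + 1) :=
    calc (s.card : ℝ) ≤ ((∑ j ∈ Finset.range N, (gridBlock Φ hpos j).card : ℕ) : ℝ) :=
          mod_cast Finset.card_biUnion_le
      _ ≤ _ := by
          push_cast
          exact Finset.sum_le_sum fun j _ => card_gridBlock_le Φ hpos j
  calc _ ≤ I.succProb * ENNReal.ofReal (1 - s.card / I.size) := by gcongr
    _ ≤ ENNReal.ofReal (‖Φ‖ ^ 2 - ∑ i ∈ s, eigenval Φ i) := I.succProb_mul_le s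
    _ = specMass (reduced Φ) (Set.Iio (y N)) := by
      rw [hsum, norm_sq_sub_sum_gridBlock Φ hpos hy hy0,
        ENNReal.ofReal_toReal (specMass_ne_top Φ _)]

end Grid

section OneShot

variable {α β : Type} {Φ : Sys (α × β)}

theorem specMass_le_one (hΦ : ‖Φ‖ = 1) (S : Set ℝ) : specMass (reduced Φ) S ≤ 1 :=
  (specMass_mono Φ (Set.subset_univ S)).trans_eq (by simp [specMass_univ, hΦ])

theorem toReal_specMass_le_one (hΦ : ‖Φ‖ = 1) (S : Set ℝ) :
    (specMass (reduced Φ) S).toReal ≤ 1 :=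
  ENNReal.toReal_le_of_le_ofReal zero_le_one (by simpa using specMass_le_one hΦ S)

theorem toReal_specMass_add_compl (hΦ : ‖Φ‖ = 1) (S : Set ℝ) :
    (specMass (reduced Φ) S).toReal + (specMass (reduced Φ) Sᶜ).toReal = 1 := by
  rw [← toReal_specMass_union Φ disjoint_compl_right, Set.union_compl_self, specMass_univ, hΦ]
  simp

theorem specMass_mul_add_fidelity_le (hΦ : ‖Φ‖ = 1) (D : DFLEC α β) {x θ : ℝ}
    (hx : 0 < x) (hθ : 0 < θ) (h : 1 ≤ θ ^ 2 * (x * D.size)) {S : Set ℝ} (hS : S ⊆ Set.Ici x) :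
    (specMass (reduced Φ) S).toReal * (1 - 2 * θ - θ ^ 2) + (D.fidelity Φ).toReal ≤ 1 := by
  have hL : (0 : ℝ) < D.size := mod_cast D.target_spec.1
  have hfin := finite_preimage_eigenval Φ hx hS
  have hhead := fun c (hc : 0 < c) => D.fidelity_le_head_add_tail (Φ := Φ) hfin.toFinset hc
  have hcard := card_mul_le_sum_eigenval Φ fun i hi => hS (hfin.mem_toFinset.mp hi)
  simp only [sum_eigenval_toFinset, hΦ, one_pow] at hhead hcard
  set m := (specMass (reduced Φ) S).toReal
  have hm0 : 0 ≤ m := ENNReal.toReal_nonneg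
  have hm1 : m ≤ 1 := toReal_specMass_le_one hΦ S
  rcases hm0.eq_or_lt with hm | hm
  · rw [← hm, zero_mul, zero_add]
    exact ENNReal.toReal_le_of_le_ofReal zero_le_one (by simpa using D.fidelity_le_one hΦ)
  have hdiv : hfin.toFinset.card / D.size ≤ θ ^ 2 * m := by
    rw [div_le_iff₀ hL]
    calc (hfin.toFinset.card : ℝ) ≤ hfin.toFinset.card * (θ ^ 2 * (x * D.size)) :=
          le_mul_of_one_le_right (Nat.cast_nonneg _) h
      _ = hfin.toFinset.card * x * (θ ^ 2 * D.size) := by ring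
      _ ≤ m * (θ ^ 2 * D.size) := by gcongr
      _ = θ ^ 2 * m * D.size := by ring
  have hfid := ENNReal.toReal_le_of_le_ofReal (by
    have : 0 ≤ 1 - m := sub_nonneg.mpr hm1
    positivity) (hhead (θ * m) (mul_pos hθ hm))
  have hmain : (1 + 1 / (θ * m)) * (hfin.toFinset.card / D.size * m) ≤ θ ^ 2 * m ^ 2 + θ * m :=
    calc _ ≤ (1 + 1 / (θ * m)) * (θ ^ 2 * m * m) := by gcongr
      _ = θ ^ 2 * m ^ 2 + θ * m := by field_simp
  nlinarith [mul_nonneg (sq_nonneg θ) (mul_nonneg hm0 (sub_nonneg.mpr hm1)),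
    mul_nonneg hθ.le (mul_nonneg hm0 hm0)]

theorem mul_eigenval_le_sum_of_le_max_floor {x t : ℝ} (hx : 0 < x) (ht : 0 ≤ t)
    {s : Finset (EigenIndex Φ)} (hs : ∀ i ∈ s, eigenval Φ i ≤ x)
    (hts : t ≤ ∑ i ∈ s, eigenval Φ i) {M : ℕ} (hM : M ≤ max 1 ⌊t / x⌋₊) :
    ∀ i ∈ s, M * eigenval Φ i ≤ ∑ k ∈ s, eigenval Φ k := by
  intro i hi
  have hpi := (eigenval_pos Φ i).le
  rcases le_max_iff.mp hM with h | h
  · calc M * eigenval Φ i ≤ (1 : ℕ) * eigenval Φ i := by gcongr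
      _ = eigenval Φ i := by rw [Nat.cast_one, one_mul]
      _ ≤ _ := Finset.single_le_sum (fun k _ => (eigenval_pos Φ k).le) hi
  · calc M * eigenval Φ i ≤ t / x * x := by
          gcongr
          · exact (Nat.cast_le.mpr h).trans (Nat.floor_le (by positivity))
          · exact hs i hi
      _ = t := div_mul_cancel₀ _ hx.ne'
      _ ≤ _ := hts

theorem half_le_max_floor (z : ℝ) : z / 2 ≤ ((max 1 ⌊z⌋₊ : ℕ) : ℝ) := by
  have hfloor := Nat.lt_floor_add_one z
  push_cast
  linarith [le_max_left (1 : ℝ) ⌊z⌋₊, le_max_right (1 : ℝ) ⌊z⌋₊]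

theorem exists_pflec_of_lt_specMass {x t : ℝ} (hx : 0 < x) (ht : 0 ≤ t) {S : Set ℝ}
    (hS : S ⊆ Set.Iic x) (h : ENNReal.ofReal t < specMass (reduced Φ) S) :
    ∃ I : PFLEC Φ, t / (2 * x) ≤ I.size ∧ ENNReal.ofReal t ≤ I.succProb := by
  obtain ⟨s, hs, hts⟩ := exists_lt_sum_eigenval Φ ht h
  obtain ⟨I, hI, hsucc⟩ := exists_pflec (M := max 1 ⌊t / x⌋₊) (by positivity)
    (Finset.nonempty_of_sum_ne_zero (ht.trans_lt hts).ne')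
    (mul_eigenval_le_sum_of_le_max_floor hx ht (fun i hi => hS (hs i hi)) hts.le le_rfl)
  refine ⟨I, ?_, hsucc ▸ ENNReal.ofReal_le_ofReal hts.le⟩
  rw [hI, mul_comm, ← div_div]
  exact half_le_max_floor _

theorem exists_dflec_of_lt_specMass {x t : ℝ} (hx : 0 < x) (ht : 0 ≤ t) {S : Set ℝ}
    (hS : S ⊆ Set.Iic x) (h : ENNReal.ofReal t < specMass (reduced Φ) S) {L : ℕ} (hL : 0 < L) :
    ∃ D : DFLEC α β, D.size = L ∧ (ENNReal.ofReal t ≤ D.fidelity Φ ∨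
      1 < L ∧ ENNReal.ofReal (t ^ 2 / (2 * x * L)) ≤ D.fidelity Φ) := by
  obtain ⟨s, hs, hts⟩ := exists_lt_sum_eigenval Φ ht h
  have hne : s.Nonempty := Finset.nonempty_of_sum_ne_zero (ht.trans_lt hts).ne'
  have hM {M : ℕ} := mul_eigenval_le_sum_of_le_max_floor hx ht
    (fun i hi => hS (hs i hi)) hts.le (M := M)
  have hL' : (0 : ℝ) < L := mod_cast hL
  rcases le_or_gt L (max 1 ⌊t / x⌋₊) with hLM | hLM
  · obtain ⟨D, hD, hF⟩ := exists_dflec hL le_rfl hne (hM hLM)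
    rw [div_self hL'.ne', one_mul] at hF
    exact ⟨D, hD, Or.inl ((ENNReal.ofReal_le_ofReal hts.le).trans hF)⟩
  · obtain ⟨D, hD, hF⟩ := exists_dflec (by positivity) hLM.le hne (hM le_rfl)
    refine ⟨D, hD, Or.inr ⟨(le_max_left _ _).trans_lt hLM, le_trans ?_ hF⟩⟩
    have hfloor := half_le_max_floor (t / x)
    gcongr
    calc t ^ 2 / (2 * x * L) = t / x / 2 / L * t := by field_simp
      _ ≤ _ := by gcongr

end OneShot

section Exponents

theorem eventually_const_mul_exp_le (C : ℝ) {a b : ℝ} (h : b < a) :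
    ∀ᶠ n : ℕ in atTop, C * Real.exp (-n * a) ≤ Real.exp (-n * b) := by
  have hexp : Tendsto (fun n : ℕ => Real.exp (n * (a - b))) atTop atTop :=
    Real.tendsto_exp_atTop.comp
      (tendsto_natCast_atTop_atTop.atTop_mul_const (sub_pos.mpr h))
  filter_upwards [hexp.eventually_ge_atTop C] with n hn
  calc C * Real.exp (-n * a) ≤ Real.exp (n * (a - b)) * Real.exp (-n * a) := by gcongr
    _ = Real.exp (-n * b) := by rw [← Real.exp_add]; congr 1; ring

theorem eventually_exp_le {C : ℝ} (hC : 0 < C) {a : ℝ} (h : 0 < a) :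
    ∀ᶠ n : ℕ in atTop, Real.exp (-n * a) ≤ C := by
  filter_upwards [eventually_const_mul_exp_le C⁻¹ h] with n hn
  rwa [mul_zero, Real.exp_zero, inv_mul_le_iff₀ hC, mul_one] at hn

theorem log_ofReal_exp_neg_mul (n : ℕ) (c : ℝ) :
    ENNReal.log (ENNReal.ofReal (Real.exp (-n * c))) = -((c : EReal) * n) := by
  rw [ENNReal.log_ofReal_of_pos (Real.exp_pos _), Real.log_exp, ← EReal.coe_coe_eq_natCast,
    ← EReal.coe_mul, ← EReal.coe_neg]
  congr 1
  ring

theorem le_expo_iff {n : ℕ} (hn : 0 < n) {p : ℝ≥0∞} {c : ℝ} :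
    (c : EReal) ≤ expo n p ↔ p ≤ ENNReal.ofReal (Real.exp (-n * c)) := by
  rw [expo, EReal.le_div_iff_mul_le (mod_cast hn) (EReal.natCast_ne_top n), EReal.le_neg,
    ← ENNReal.log_le_log_iff, log_ofReal_exp_neg_mul]

theorem expo_le_iff {n : ℕ} (hn : 0 < n) {p : ℝ≥0∞} {c : ℝ} :
    expo n p ≤ (c : EReal) ↔ ENNReal.ofReal (Real.exp (-n * c)) ≤ p := by
  rw [expo, EReal.div_le_iff_le_mul (mod_cast hn) (EReal.natCast_ne_top n), EReal.neg_le,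
    ← ENNReal.log_le_log_iff, log_ofReal_exp_neg_mul, mul_comm]

theorem expo_anti (n : ℕ) {p q : ℝ≥0∞} (h : p ≤ q) : expo n q ≤ expo n p :=
  EReal.div_le_div_right_of_nonneg (by positivity)
    (EReal.neg_le_neg_iff.mpr (ENNReal.log_le_log h))

theorem le_liminf_expo_iff {u : ℕ → ℝ≥0∞} {r : ℝ} :
    (r : EReal) ≤ liminf (fun n => expo n (u n)) atTop ↔
      ∀ r' < r, ∀ᶠ n : ℕ in atTop, u n ≤ ENNReal.ofReal (Real.exp (-n * r')) := by
  rw [le_liminf_iff]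
  constructor
  · intro h r' hr'
    filter_upwards [h r' (mod_cast hr'), eventually_gt_atTop 0] with n hn hn0
    exact (le_expo_iff hn0).mp hn.le
  · intro h y hy
    obtain ⟨r', hyr', hr'⟩ := EReal.lt_iff_exists_real_btwn.mp hy
    filter_upwards [h r' (mod_cast hr'), eventually_gt_atTop 0] with n hn hn0
    exact hyr'.trans_le ((le_expo_iff hn0).mpr hn)

theorem limsup_expo_le_iff {u : ℕ → ℝ≥0∞} {r : ℝ} :
    limsup (fun n => expo n (u n)) atTop ≤ (r : EReal) ↔
      ∀ r' > r, ∀ᶠ n : ℕ in atTop, ENNReal.ofReal (Real.exp (-n * r')) ≤ u n := by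
  rw [limsup_le_iff]
  constructor
  · intro h r' hr'
    filter_upwards [h r' (mod_cast hr'), eventually_gt_atTop 0] with n hn hn0
    exact (expo_le_iff hn0).mp hn.le
  · intro h y hy
    obtain ⟨r', hr', hr'y⟩ := EReal.lt_iff_exists_real_btwn.mp hy
    filter_upwards [h r' (mod_cast hr'), eventually_gt_atTop 0] with n hn hn0
    exact ((expo_le_iff hn0).mpr hn).trans_lt hr'y

theorem le_log_div_iff {n L : ℕ} (hn : 0 < n) (hL : 0 < L) {R : ℝ} :
    R ≤ Real.log L / n ↔ Real.exp (n * R) ≤ L := by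
  rw [le_div_iff₀ (mod_cast hn), Real.le_log_iff_exp_le (mod_cast hL), mul_comm]

theorem eventually_le_of_lt_rate {L : ℕ → ℕ} (hL : ∀ n, 0 < L n) {R : ℝ}
    (h : (R : EReal) < rate L) : ∀ᶠ n : ℕ in atTop, Real.exp (n * R) ≤ L n := by
  filter_upwards [eventually_lt_of_lt_liminf h, eventually_gt_atTop 0] with n hn hn0
  exact (le_log_div_iff hn0 (hL n)).mp (EReal.coe_lt_coe_iff.mp hn).le

theorem le_rate {L : ℕ → ℕ} (hL : ∀ n, 0 < L n) {R : ℝ}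
    (h : ∀ R' < R, ∀ᶠ n : ℕ in atTop, Real.exp (n * R') ≤ L n) : (R : EReal) ≤ rate L := by
  rw [rate, le_liminf_iff]
  intro y hy
  obtain ⟨R', hyR', hR'⟩ := EReal.lt_iff_exists_real_btwn.mp hy
  filter_upwards [h R' (mod_cast hR'), eventually_gt_atTop 0] with n hn hn0
  exact hyR'.trans_le (EReal.coe_le_coe_iff.mpr ((le_log_div_iff hn0 (hL n)).mpr hn))

theorem le_rate_of_const_mul {L : ℕ → ℕ} (hL : ∀ n, 0 < L n) {R C : ℝ} (hC : 0 < C)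
    (h : ∀ R' < R, ∀ᶠ n : ℕ in atTop, C * Real.exp (n * R') ≤ L n) : (R : EReal) ≤ rate L := by
  refine le_rate hL fun R' hR' => ?_
  obtain ⟨R'', hR'R'', hR''⟩ := exists_between hR'
  filter_upwards [h R'' hR'', eventually_const_mul_exp_le C⁻¹ (neg_lt_neg hR'R'')] with n hn hn'
  rw [neg_mul_neg, neg_mul_neg, inv_mul_le_iff₀ hC] at hn'
  exact hn'.trans hn

theorem le_rate_ceil_exp (R : ℝ) : (R : EReal) ≤ rate fun n => ⌈Real.exp (n * R)⌉₊ := by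
  refine le_rate (fun n => Nat.ceil_pos.mpr (Real.exp_pos _)) fun R' hR' =>
    Eventually.of_forall fun n => le_trans (Real.exp_le_exp.mpr ?_) (Nat.le_ceil _)
  gcongr

theorem limsup_le_ofReal_iff {u : ℕ → ℝ≥0∞} {ε : ℝ} (hε : 0 ≤ ε) :
    limsup u atTop ≤ ENNReal.ofReal ε ↔
      ∀ z > ε, ∀ᶠ n in atTop, u n ≤ ENNReal.ofReal z := by
  rw [limsup_le_iff]
  constructor
  · intro h z hz
    filter_upwards [h _ ((ENNReal.ofReal_lt_ofReal_iff (hε.trans_lt hz)).mpr hz)] with n hn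
    exact hn.le
  · intro h y hy
    obtain ⟨z, -, hεz, hzy⟩ := ENNReal.lt_iff_exists_real_btwn.mp hy
    filter_upwards [h z ((ENNReal.ofReal_lt_ofReal_iff_of_nonneg hε).mp hεz)] with n hn
    exact hn.trans_lt hzy

theorem ofReal_one_sub_le_liminf_iff {u : ℕ → ℝ≥0∞} {ε : ℝ} :
    ENNReal.ofReal (1 - ε) ≤ liminf u atTop ↔
      ∀ z > ε, ∀ᶠ n in atTop, ENNReal.ofReal (1 - z) ≤ u n := by
  rw [le_liminf_iff]
  constructor
  · intro h z hz
    rcases le_or_gt (1 - ε) 0 with hε | hε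
    · refine Eventually.of_forall fun n => ?_
      rw [ENNReal.ofReal_of_nonpos (by linarith)]
      exact zero_le
    · filter_upwards [h (ENNReal.ofReal (1 - z))
        ((ENNReal.ofReal_lt_ofReal_iff hε).mpr (by linarith))] with n hn
      exact hn.le
  · intro h y hy
    obtain ⟨z, hz0, hyz, hz⟩ := ENNReal.lt_iff_exists_real_btwn.mp hy
    have hlt := (ENNReal.ofReal_lt_ofReal_iff_of_nonneg hz0).mp hz
    filter_upwards [h (1 - z) (by linarith)] with n hn
    rw [sub_sub_cancel] at hn
    exact hyz.trans_le hn

end Exponents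

section WeakRates

section OneShot

variable {α β : Type} {Φ : Sys (α × β)}

theorem DFLEC.fidelity_ne_top (D : DFLEC α β) : D.fidelity Φ ≠ ⊤ := ENNReal.ofReal_ne_top

namespace PFLEC

variable (I : PFLEC Φ) (hΦ : ‖Φ‖ = 1)
include hΦ

theorem failProb_le_one : I.failProb ≤ 1 := le_add_self.trans_eq (I.succProb_add_failProb hΦ)

theorem succProb_le_one : I.succProb ≤ 1 := le_self_add.trans_eq (I.succProb_add_failProb hΦ)

theorem failProb_eq : I.failProb = 1 - I.succProb :=
  ENNReal.eq_sub_of_add_eq (ne_top_of_le_ne_top ENNReal.one_ne_top (I.succProb_le_one hΦ))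
    (by rw [add_comm, I.succProb_add_failProb hΦ])

theorem failProb_le {t : ℝ} (ht : 0 ≤ t) (h : ENNReal.ofReal t ≤ I.succProb) :
    I.failProb ≤ ENNReal.ofReal (1 - t) := by
  rw [I.failProb_eq hΦ, ENNReal.ofReal_sub _ ht, ENNReal.ofReal_one]
  exact tsub_le_tsub_left h 1

end PFLEC

end OneShot

variable {ι κ : ℕ → Type} {Φ : ∀ n, Sys (ι n × κ n)}

theorem exists_pflec_rate (Φ : ∀ n, Sys (ι n × κ n)) (R : ℝ) :
    ∃ I : ∀ n, PFLEC (Φ n), (R : EReal) ≤ rate fun n => (I n).size := by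
  choose I hI using fun n : ℕ => exists_pflec_size (Φ n) (Nat.ceil_pos.mpr (Real.exp_pos (n * R)))
  exact ⟨I, by simpa only [hI] using le_rate_ceil_exp R⟩

theorem exists_pflec_seq {x : ℕ → ℝ} (hx : ∀ n, 0 < x n) {S : ℕ → Set ℝ}
    (hS : ∀ n, S n ⊆ Set.Iic (x n)) (t : ℕ → ℝ) :
    ∃ I : ∀ n, PFLEC (Φ n), ∀ n, 0 ≤ t n →
      ENNReal.ofReal (t n) < specMass (reduced (Φ n)) (S n) →
      t n / (2 * x n) ≤ (I n).size ∧ ENNReal.ofReal (t n) ≤ (I n).succProb := by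
  have hex : ∀ n, ∃ I : PFLEC (Φ n), 0 ≤ t n →
      ENNReal.ofReal (t n) < specMass (reduced (Φ n)) (S n) →
      t n / (2 * x n) ≤ I.size ∧ ENNReal.ofReal (t n) ≤ I.succProb := fun n => by
    by_cases h : 0 ≤ t n ∧ ENNReal.ofReal (t n) < specMass (reduced (Φ n)) (S n)
    · obtain ⟨I, hI⟩ := exists_pflec_of_lt_specMass (hx n) h.1 (hS n) h.2
      exact ⟨I, fun _ _ => hI⟩
    · obtain ⟨I, -⟩ := exists_pflec_size (Φ n) one_pos
      exact ⟨I, fun ht hlt => absurd ⟨ht, hlt⟩ h⟩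
  choose I hI using hex
  exact ⟨I, hI⟩

theorem le_rate_of_pflec_size {I : ∀ n, PFLEC (Φ n)} {R C : ℝ} {t : ℕ → ℝ} (hC : 0 < C)
    (h : ∀ᶠ n : ℕ in atTop, C ≤ t n ∧ t n / (2 * Real.exp (-n * R)) ≤ (I n).size) :
    (R : EReal) ≤ rate fun n => (I n).size := by
  refine le_rate_of_const_mul (fun n => (I n).target_spec.1) (half_pos hC) fun R' hR' => ?_
  filter_upwards [h] with n ⟨hCt, hsize⟩
  have ht : 0 ≤ t n := hC.le.trans hCt
  calc C / 2 * Real.exp (n * R') ≤ t n / 2 * Real.exp (n * R) := by gcongr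
    _ = t n / (2 * Real.exp (-n * R)) := by
        rw [neg_mul, Real.exp_neg]
        field_simp
    _ ≤ _ := hsize

theorem exists_pflec_seq_failProb_le (hΦ : ∀ n, ‖Φ n‖ = 1) {R C : ℝ} (hC : 0 < C)
    {S : ℕ → Set ℝ} (hS : ∀ n : ℕ, S n ⊆ Set.Iic (Real.exp (-n * R))) {δ : ℕ → ℝ}
    (hδ : ∀ n, 0 < δ n)
    (h : ∀ᶠ n in atTop, (specMass (reduced (Φ n)) (S n)ᶜ).toReal + δ n ≤ 1 - C) :
    ∃ I : ∀ n, PFLEC (Φ n), (R : EReal) ≤ rate (fun n => (I n).size) ∧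
      ∀ᶠ n in atTop, (I n).failProb ≤
        ENNReal.ofReal ((specMass (reduced (Φ n)) (S n)ᶜ).toReal + δ n) := by
  set m : ℕ → ℝ := fun n => (specMass (reduced (Φ n)) (S n)ᶜ).toReal
  obtain ⟨I, hI⟩ := exists_pflec_seq (Φ := Φ) (fun n : ℕ => Real.exp_pos (-n * R)) hS
    fun n => 1 - (m n + δ n)
  have hev : ∀ᶠ n in atTop, C ≤ 1 - (m n + δ n) ∧
      (1 - (m n + δ n)) / (2 * Real.exp (-n * R)) ≤ (I n).size ∧
      (I n).failProb ≤ ENNReal.ofReal (m n + δ n) := by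
    filter_upwards [h] with n hn
    have hC' : C ≤ 1 - (m n + δ n) := le_sub_comm.mp hn
    have ht : 0 ≤ 1 - (m n + δ n) := hC.le.trans hC'
    obtain ⟨hsize, hsucc⟩ := hI n ht <| by
      rw [ENNReal.ofReal_lt_iff_lt_toReal ht (specMass_ne_top (Φ n) _)]
      linarith [toReal_specMass_add_compl (hΦ n) (S n), hδ n]
    exact ⟨hC', hsize, by simpa only [sub_sub_cancel] using (I n).failProb_le (hΦ n) ht hsucc⟩
  exact ⟨I, le_rate_of_pflec_size hC (hev.mono fun n hn => ⟨hn.1, hn.2.1⟩),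
    hev.mono fun n hn => hn.2.2⟩

theorem eventually_specMass_mul_add_fidelity_le (hΦ : ∀ n, ‖Φ n‖ = 1)
    {D : ∀ n, DFLEC (ι n) (κ n)} {R : ℝ} (hR : (R : EReal) < rate fun n => (D n).size)
    {S : ℕ → Set ℝ} (hS : ∀ n : ℕ, S n ⊆ Set.Ici (Real.exp (-n * R))) {δ : ℝ} (hδ : 0 < δ) :
    ∀ᶠ n in atTop, (specMass (reduced (Φ n)) (S n)).toReal * (1 - δ) +
      ((D n).fidelity (Φ n)).toReal ≤ 1 := by
  obtain ⟨R', hRR', hR'⟩ := EReal.lt_iff_exists_real_btwn.mp hR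
  have hgap : 0 < (R' - R) / 2 := half_pos (sub_pos.mpr (mod_cast hRR'))
  filter_upwards [eventually_le_of_lt_rate (fun n => (D n).target_spec.1) hR',
    eventually_exp_le one_pos hgap, eventually_exp_le (C := δ / 3) (by linarith) hgap]
    with n hsize hθ1 hθδ
  set θ := Real.exp (-n * ((R' - R) / 2)) with hθ
  have hθ0 : 0 < θ := Real.exp_pos _
  have hθL : 1 ≤ θ ^ 2 * (Real.exp (-n * R) * (D n).size) :=
    calc (1 : ℝ) = θ ^ 2 * (Real.exp (-n * R) * Real.exp (n * R')) := by
          rw [hθ, sq, ← Real.exp_add, ← Real.exp_add, ← Real.exp_add, ← Real.exp_zero]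
          congr 1
          ring
      _ ≤ _ := by gcongr
  have hδθ : 1 - δ ≤ 1 - 2 * θ - θ ^ 2 := by nlinarith
  refine le_trans ?_ (specMass_mul_add_fidelity_le (hΦ n) (D n) (Real.exp_pos _) hθ0 hθL (hS n))
  gcongr ?_ * ?_ + _

theorem le_BP (hΦ : ∀ n, ‖Φ n‖ = 1) {ε : ℝ} (h0 : 0 ≤ ε) (h1 : ε ≤ 1) {R : ℝ}
    (hR : K Φ R ≤ ENNReal.ofReal ε) : (R : EReal) ≤ BP Φ ε := by
  rcases h1.eq_or_lt with rfl | h1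
  · obtain ⟨I, hI⟩ := exists_pflec_rate Φ R
    refine le_iSup₂_of_le I ((limsup_le_ofReal_iff h0).mpr fun z hz =>
      Eventually.of_forall fun n => ((I n).failProb_le_one (hΦ n)).trans ?_) hI
    exact ENNReal.one_le_ofReal.mpr hz.le
  have hm : ∀ z > ε, ∀ᶠ n : ℕ in atTop,
      (specMass (reduced (Φ n)) (Set.Ici (Real.exp (-n * R)))).toReal ≤ z := fun z hz => by
    filter_upwards [(limsup_le_ofReal_iff h0).mp hR z hz] with n hn
    exact ENNReal.toReal_le_of_le_ofReal (h0.trans hz.le) hn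
  have hδ : ∀ d > (0 : ℝ), ∀ᶠ n : ℕ in atTop, 1 / ((n : ℝ) + 1) ≤ d := fun d hd =>
    ((tendsto_one_div_add_atTop_nhds_zero_nat (𝕜 := ℝ)).eventually_lt_const hd).mono
      fun _ hn => hn.le
  obtain ⟨I, hI, hfail⟩ := exists_pflec_seq_failProb_le hΦ (C := (1 - ε) / 4) (by linarith)
    (S := fun n => Set.Iio (Real.exp (-n * R))) (δ := fun n => 1 / ((n : ℝ) + 1))
    (fun n => Set.Iio_subset_Iic_self) (fun n => by positivity) <| by
      filter_upwards [hm (ε + (1 - ε) / 2) (by linarith), hδ ((1 - ε) / 4) (by linarith)]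
        with n hmn hδn
      rw [Set.compl_Iio]
      linarith
  refine le_iSup₂_of_le I ((limsup_le_ofReal_iff h0).mpr fun z hz => ?_) hI
  filter_upwards [hfail, hm (ε + (z - ε) / 2) (by linarith), hδ ((z - ε) / 2) (by linarith)]
    with n hn hmn hδn
  rw [Set.compl_Iio] at hn
  exact hn.trans (ENNReal.ofReal_le_ofReal (by linarith))

theorem BP_le_BD (hΦ : ∀ n, ‖Φ n‖ = 1) {ε : ℝ} (h0 : 0 ≤ ε) : BP Φ ε ≤ BD Φ ε := by
  refine iSup₂_le fun I hI => le_iSup₂_of_le (fun n => (I n).toDFLEC)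
    (ofReal_one_sub_le_liminf_iff.mpr fun z hz => ?_) le_rfl
  filter_upwards [(limsup_le_ofReal_iff h0).mp hI z hz] with n hn
  refine le_trans ?_ (I n).succProb_le_fidelity
  rw [ENNReal.ofReal_sub _ (h0.trans hz.le), ENNReal.ofReal_one, tsub_le_iff_right,
    ← (I n).succProb_add_failProb (hΦ n)]
  gcongr

theorem BD_le (hΦ : ∀ n, ‖Φ n‖ = 1) {ε : ℝ} (h0 : 0 ≤ ε) :
    BD Φ ε ≤ ⨆ (R : ℝ) (_ : K Φ R ≤ ENNReal.ofReal ε), (R : EReal) := by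
  refine iSup₂_le fun D hD => EReal.ge_of_forall_gt_iff_ge.mp fun R hR => ?_
  refine le_iSup₂_of_le R ((limsup_le_ofReal_iff h0).mpr fun z hz => ?_) le_rfl
  obtain ⟨w, hεw, hwz⟩ := exists_between hz
  filter_upwards [ofReal_one_sub_le_liminf_iff.mp hD w hεw,
    eventually_specMass_mul_add_fidelity_le hΦ hR (fun _ => subset_rfl) (sub_pos.mpr hwz)]
    with n hfid hn
  rw [ENNReal.ofReal_le_iff_le_toReal (D n).fidelity_ne_top] at hfid
  rw [ENNReal.le_ofReal_iff_toReal_le (specMass_ne_top (Φ n) _) (h0.trans hz.le)]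
  nlinarith [toReal_specMass_le_one (hΦ n) (Set.Ici (Real.exp (-n * R)))]

theorem le_BeP (hΦ : ∀ n, ‖Φ n‖ = 1) {r R : ℝ} (hR : (r : EReal) ≤ zetaC Φ R) :
    (R : EReal) ≤ BeP Φ r := by
  rcases le_or_gt r 0 with hr | hr
  · obtain ⟨I, hI⟩ := exists_pflec_rate Φ R
    refine le_iSup₂_of_le I (le_liminf_expo_iff.mpr fun r' hr' =>
      Eventually.of_forall fun n => ((I n).failProb_le_one (hΦ n)).trans ?_) hI
    refine ENNReal.one_le_ofReal.mpr (Real.one_le_exp ?_)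
    rw [neg_mul, ← mul_neg]
    exact mul_nonneg n.cast_nonneg (neg_nonneg.mpr (hr'.le.trans hr))
  have hm : ∀ r' < r, ∀ᶠ n : ℕ in atTop,
      (specMass (reduced (Φ n)) (Set.Ioi (Real.exp (-n * R)))).toReal ≤ Real.exp (-n * r') :=
    fun r' hr' => by
      filter_upwards [le_liminf_expo_iff.mp hR r' hr'] with n hn
      exact ENNReal.toReal_le_of_le_ofReal (Real.exp_pos _).le hn
  obtain ⟨I, hI, hfail⟩ := exists_pflec_seq_failProb_le hΦ (C := 1 / 2) (by norm_num)
    (S := fun n => Set.Iic (Real.exp (-n * R))) (δ := fun n => Real.exp (-n * r))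
    (fun n => subset_rfl) (fun n => Real.exp_pos _) <| by
      filter_upwards [hm (r / 2) (by linarith),
        eventually_exp_le (C := 1 / 4) (by norm_num) (half_pos hr),
        eventually_exp_le (C := 1 / 4) (by norm_num) hr] with n hmn hhalf hrn
      rw [Set.compl_Iic]
      linarith
  refine le_iSup₂_of_le I (le_liminf_expo_iff.mpr fun r' hr' => ?_) hI
  obtain ⟨r'', hr'', hr''r⟩ := exists_between hr'
  filter_upwards [hfail, hm r'' hr''r, eventually_const_mul_exp_le 1 hr''r,
    eventually_const_mul_exp_le 2 hr''] with n hn hmn hδn hexp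
  rw [Set.compl_Iic] at hn
  exact hn.trans (ENNReal.ofReal_le_ofReal (by linarith))

theorem BeP_le_BeD (hΦ : ∀ n, ‖Φ n‖ = 1) (r : ℝ) : BeP Φ r ≤ BeD Φ r := by
  refine iSup₂_le fun I hI => le_iSup₂_of_le (fun n => (I n).toDFLEC)
    (hI.trans (liminf_le_liminf (Eventually.of_forall fun n => expo_anti n ?_))) le_rfl
  rw [(I n).failProb_eq (hΦ n)]
  exact tsub_le_tsub_left (I n).succProb_le_fidelity 1

theorem BeD_le (hΦ : ∀ n, ‖Φ n‖ = 1) (r : ℝ) :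
    BeD Φ r ≤ ⨆ (R : ℝ) (_ : (r : EReal) ≤ zetaC Φ R), (R : EReal) := by
  refine iSup₂_le fun D hD => EReal.ge_of_forall_gt_iff_ge.mp fun R hR => ?_
  refine le_iSup₂_of_le R (le_liminf_expo_iff.mpr fun r' hr' => ?_) le_rfl
  obtain ⟨r'', hr'', hr''r⟩ := exists_between hr'
  filter_upwards [le_liminf_expo_iff.mp hD r'' hr''r, eventually_const_mul_exp_le 2 hr'',
    eventually_specMass_mul_add_fidelity_le hΦ hR (fun _ => Set.Ioi_subset_Ici_self) one_half_pos]
    with n hfid hexp hn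
  have hinfid := ENNReal.toReal_le_of_le_ofReal (Real.exp_pos _).le hfid
  rw [ENNReal.toReal_sub_of_le ((D n).fidelity_le_one (hΦ n)) ENNReal.one_ne_top,
    ENNReal.toReal_one] at hinfid
  rw [ENNReal.le_ofReal_iff_toReal_le (specMass_ne_top (Φ n) _) (Real.exp_pos _).le]
  linarith

end WeakRates

section StrongConverse

theorem not_eventually_le_const_mul_exp {u : ℕ → ℝ≥0∞} {r c C : ℝ} (hrc : r < c)
    (hu : limsup (fun n => expo n (u n)) atTop ≤ (r : EReal)) :
    ¬ ∀ᶠ n : ℕ in atTop, u n ≤ ENNReal.ofReal (C * Real.exp (-n * c)) := by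
  intro hle
  obtain ⟨s, hrs, hsc⟩ := exists_between hrc
  obtain ⟨q, hrq, hqs⟩ := exists_between hrs
  obtain ⟨n, hlower, hupper, hexp, hn⟩ := ((limsup_expo_le_iff.mp hu q hrq).and
    (hle.and ((eventually_const_mul_exp_le C hsc).and (eventually_gt_atTop 0)))).exists
  have hqn : Real.exp (-n * q) ≤ Real.exp (-n * s) :=
    (ENNReal.ofReal_le_ofReal_iff (Real.exp_pos _).le).mp
      (hlower.trans (hupper.trans (ENNReal.ofReal_le_ofReal hexp)))
  have hn' : (0 : ℝ) < n := mod_cast hn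
  rw [Real.exp_le_exp] at hqn
  nlinarith

theorem coe_sub_add_lt_of_lt_infHalf_add {ζ : ℝ → EReal} {a a' b c : ℝ}
    (h : (c : EReal) < infHalf ζ a + b) (ha : a' ≤ a) : ((c - b + a' / 2 : ℝ) : EReal) < ζ a' := by
  have hlt : ((c - b : ℝ) : EReal) < ζ a' - (a' / 2 : ℝ) :=
    (EReal.sub_lt_of_lt_add h).trans_le (iInf₂_le a' ha)
  exact_mod_cast EReal.add_lt_of_lt_sub hlt

section Grid

variable {α β : Type} {Φ : Sys (α × β)} {n N : ℕ} {b h : ℝ}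

theorem antitone_exp_grid (n : ℕ) (b : ℝ) (hh : 0 ≤ h) :
    Antitone fun j : ℕ => Real.exp (-n * (b + j * h)) := fun i j hij => by
  refine Real.exp_le_exp.mpr ?_
  rw [neg_mul, neg_mul, neg_le_neg_iff]
  gcongr

theorem fidelity_le_exp_grid (D : DFLEC α β) {c : ℝ} (hh : 0 ≤ h)
    (hb : ‖Φ‖ ^ 2 < Real.exp (-n * b))
    (hmass : ∀ j ∈ Finset.range (N + 1),
      (specMass (reduced Φ) (Set.Iio (Real.exp (-n * (b + j * h))))).toReal ≤
        Real.exp (-n * (c - (N - j) * h / 2)))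
    (hsize : Real.exp (n * (b + (N + 1) * h - c)) ≤ D.size) :
    D.fidelity Φ ≤ ENNReal.ofReal ((N + 1) * (N + 1) * Real.exp (-n * c)) := by
  set y : ℕ → ℝ := fun j => Real.exp (-n * (b + j * h))
  refine (fidelity_le_grid (fun j => Real.exp_pos _) D (antitone_exp_grid n b hh)
    (by simpa using hb) N).trans (ENNReal.ofReal_le_ofReal ?_)
  have hterm : ∀ j ∈ Finset.range N,
      (specMass (reduced Φ) (Set.Iio (y j))).toReal ^ 2 / (y (j + 1) * D.size) ≤
        Real.exp (-n * c) := fun j hj =>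
    calc _ ≤ Real.exp (-n * (c - (N - j) * h / 2)) ^ 2 /
          (y (j + 1) * Real.exp (n * (b + (N + 1) * h - c))) := by
          have := hmass j (Finset.range_mono N.le_succ hj)
          gcongr
      _ = Real.exp (-n * c) := by
          rw [sq, ← Real.exp_add, ← Real.exp_add, ← Real.exp_sub]
          congr 1
          push_cast
          ring
  have hsum := Finset.sum_le_card_nsmul _ _ _ hterm
  rw [Finset.card_range, nsmul_eq_mul] at hsum
  have hlast := hmass N (Finset.self_mem_range_succ N)
  rw [sub_self, zero_mul, zero_div, sub_zero] at hlast
  calc _ ≤ ((N : ℝ) + 1) * (N * Real.exp (-n * c) + Real.exp (-n * c)) := by gcongr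
    _ = _ := by ring

theorem succProb_le_exp_grid (I : PFLEC Φ) {q : ℝ} (hh : 0 ≤ h)
    (hb : ‖Φ‖ ^ 2 < Real.exp (-n * b)) (hN : 2 * N * Real.exp (-n * h) ≤ 1)
    (hmass : ∀ j ∈ Finset.range N,
      (specMass (reduced Φ) (Set.Iio (Real.exp (-n * (b + j * h))))).toReal ≤
        Real.exp (-n * (b + j * h - q)))
    (hsize : Real.exp (n * (q + 2 * h)) ≤ I.size) :
    I.succProb ≤ 2 * specMass (reduced Φ) (Set.Iio (Real.exp (-n * (b + N * h)))) := by
  set y : ℕ → ℝ := fun j => Real.exp (-n * (b + j * h))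
  have hterm : ∀ j ∈ Finset.range N,
      (specMass (reduced Φ) (Set.Iio (y j))).toReal / y (j + 1) ≤ Real.exp (n * (q + h)) :=
    fun j hj =>
    calc _ ≤ Real.exp (-n * (b + j * h - q)) / y (j + 1) := by
          gcongr
          exact hmass j hj
      _ = _ := by
          rw [← Real.exp_sub]
          congr 1
          push_cast
          ring
  have hsum := Finset.sum_le_card_nsmul _ _ _ hterm
  rw [Finset.card_range, nsmul_eq_mul] at hsum
  have hratio : (∑ j ∈ Finset.range N, (specMass (reduced Φ) (Set.Iio (y j))).toReal / y (j + 1)) /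
      I.size ≤ 1 / 2 :=
    calc _ ≤ N * Real.exp (n * (q + h)) / Real.exp (n * (q + 2 * h)) := by gcongr
      _ = N * Real.exp (-n * h) := by
          rw [mul_div_assoc, ← Real.exp_sub]
          congr 2
          ring
      _ ≤ 1 / 2 := by linarith
  have hhalf : I.succProb * 2⁻¹ ≤ specMass (reduced Φ) (Set.Iio (y N)) := by
    refine le_trans ?_ (succProb_mul_le_grid (fun j => Real.exp_pos _) I (antitone_exp_grid n b hh)
      (by simpa using hb) N)
    gcongr
    rw [← ENNReal.ofReal_ofNat 2, ← ENNReal.ofReal_inv_of_pos two_pos]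
    exact ENNReal.ofReal_le_ofReal (by linarith)
  rwa [← div_eq_mul_inv, ENNReal.div_le_iff two_ne_zero ENNReal.ofNat_ne_top, mul_comm] at hhalf

end Grid

variable {ι κ : ℕ → Type} {Φ : ∀ n, Sys (ι n × κ n)} {ζ : ℝ → EReal}

theorem IsZeta.eventually_le (hζ : IsZeta Φ ζ) {a c : ℝ} (h : (c : EReal) < ζ a) :
    ∀ᶠ n : ℕ in atTop, (specMass (reduced (Φ n)) (Set.Iio (Real.exp (-n * a)))).toReal ≤
      Real.exp (-n * c) := by
  filter_upwards [(hζ a).eventually_const_lt h, eventually_gt_atTop 0] with n hn hn0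
  exact ENNReal.toReal_le_of_le_ofReal (Real.exp_pos _).le ((le_expo_iff hn0).mp hn.le)

theorem infHalf_add_le_of_limsup_le (hζ : IsZeta Φ ζ) (hΦ : ∀ n, ‖Φ n‖ = 1)
    {D : ∀ n, DFLEC (ι n) (κ n)} {r R : ℝ}
    (hD : limsup (fun n => expo n ((D n).fidelity (Φ n))) atTop ≤ (r : EReal))
    (hR : (R : EReal) < rate fun n => (D n).size) :
    infHalf ζ (R + r) + (((R + r) / 2 : ℝ) : EReal) ≤ r := by
  by_contra! hlt
  obtain ⟨c, hrc, hc⟩ := EReal.lt_iff_exists_real_btwn.mp hlt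
  have hrc' : r < c := mod_cast hrc
  set h := c - r with hh
  have hh0 : 0 < h := sub_pos.mpr hrc'
  obtain ⟨N, hN⟩ := exists_nat_gt ((R + r) / h)
  rw [div_lt_iff₀ hh0] at hN
  set b := R + r - N * h with hb
  have hmass : ∀ j ∈ Finset.range (N + 1), ∀ᶠ n : ℕ in atTop,
      (specMass (reduced (Φ n)) (Set.Iio (Real.exp (-n * (b + j * h))))).toReal ≤
        Real.exp (-n * (c - (N - j) * h / 2)) := fun j hj => by
    have hjN : (j : ℝ) ≤ N := mod_cast Nat.lt_succ_iff.mp (Finset.mem_range.mp hj)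
    refine hζ.eventually_le ?_
    convert coe_sub_add_lt_of_lt_infHalf_add hc (a' := b + j * h) (by nlinarith) using 2
    ring
  refine not_eventually_le_const_mul_exp (C := (N + 1) * (N + 1)) hrc' hD ?_
  filter_upwards [(eventually_all_finset _).mpr hmass,
    eventually_le_of_lt_rate (fun n => (D n).target_spec.1) hR, eventually_gt_atTop 0]
    with n hmass hsize hn
  have hn' : (0 : ℝ) < n := mod_cast hn
  refine fidelity_le_exp_grid (D n) hh0.le ?_ hmass ?_
  · rw [hΦ, one_pow, Real.one_lt_exp_iff]
    nlinarith
  · convert hsize using 3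
    rw [hb, hh]
    ring

theorem BeDStar_le (hζ : IsZeta Φ ζ) (hΦ : ∀ n, ‖Φ n‖ = 1) (r : ℝ) :
    BeDStar Φ r ≤ ⨆ (a : ℝ) (_ : infHalf ζ a + ((a / 2 : ℝ) : EReal) ≤ r),
      ((a - r : ℝ) : EReal) := by
  refine iSup₂_le fun D hD => EReal.ge_of_forall_gt_iff_ge.mp fun R hR => ?_
  refine le_iSup₂_of_le (R + r) (infHalf_add_le_of_limsup_le hζ hΦ hD hR) ?_
  rw [add_sub_cancel_right]

theorem rate_le_of_limsup_expo_succProb_le (hζ : IsZeta Φ ζ) (hΦ : ∀ n, ‖Φ n‖ = 1)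
    {I : ∀ n, PFLEC (Φ n)} {r s : ℝ}
    (hI : limsup (fun n => expo n (I n).succProb) atTop ≤ (r : EReal))
    (hs : ∀ a : ℝ, ζ a ≤ r → ((a - s : ℝ) : EReal) ≤ ζ a) : rate (fun n => (I n).size) ≤ s := by
  by_contra! hlt
  obtain ⟨R, hsR, hR⟩ := EReal.lt_iff_exists_real_btwn.mp hlt
  have hsR' : s < R := mod_cast hsR
  set h := (R - s) / 3 with hh
  have hh0 : 0 < h := by linarith
  -- Below the first grid point with `ζ > r` the hypothesis `hs` bounds the mass of each block; the
  -- mass beyond it decays too fast for the success probability allowed by `hI`.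
  have hex : ∃ N : ℕ, (r : EReal) < ζ (-1 + N * h) := by
    obtain ⟨N, hN⟩ := exists_nat_gt ((s + r + 1) / h)
    rw [div_lt_iff₀ hh0] at hN
    refine ⟨N, not_le.mp fun hle => ?_⟩
    have := EReal.coe_le_coe_iff.mp ((hs _ hle).trans hle)
    linarith
  classical
  obtain ⟨N, hN, hmin⟩ := Nat.findX hex
  obtain ⟨c, hrc, hc⟩ := EReal.lt_iff_exists_real_btwn.mp hN
  have hmass : ∀ j ∈ Finset.range N, ∀ᶠ n : ℕ in atTop,
      (specMass (reduced (Φ n)) (Set.Iio (Real.exp (-n * (-1 + j * h))))).toReal ≤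
        Real.exp (-n * (-1 + j * h - (s + h))) := fun j hj =>
    hζ.eventually_le <| (EReal.coe_lt_coe_iff.mpr (by linarith)).trans_le
      (hs _ (not_lt.mp (hmin j (Finset.mem_range.mp hj))))
  refine not_eventually_le_const_mul_exp (C := 2) (mod_cast hrc) hI ?_
  filter_upwards [(eventually_all_finset _).mpr hmass, hζ.eventually_le hc,
    eventually_le_of_lt_rate (fun n => (I n).target_spec.1) hR,
    eventually_const_mul_exp_le (2 * N) hh0, eventually_gt_atTop 0]
    with n hmass hlast hsize hNn hn
  have hsucc := succProb_le_exp_grid (I n) hh0.le (by simpa [hΦ] using hn) (by simpa using hNn)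
    hmass (by convert hsize using 3; rw [hh]; ring)
  refine hsucc.trans ?_
  rw [ENNReal.ofReal_mul zero_le_two, ENNReal.ofReal_ofNat]
  gcongr
  exact (ENNReal.le_ofReal_iff_toReal_le (specMass_ne_top (Φ n) _) (Real.exp_pos _).le).mpr hlast

theorem BePStar_le (hζ : IsZeta Φ ζ) (hΦ : ∀ n, ‖Φ n‖ = 1) (r : ℝ) :
    BePStar Φ r ≤ ⨆ (a : ℝ) (_ : ζ a ≤ r), ((a : EReal) - ζ a) := by
  refine iSup₂_le fun I hI => EReal.le_of_forall_lt_iff_le.mp fun s hs => ?_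
  refine rate_le_of_limsup_expo_succProb_le hζ hΦ hI fun a ha => ?_
  have hsub : (a : EReal) - ζ a ≤ s :=
    (le_iSup₂ (f := fun (a : ℝ) (_ : ζ a ≤ r) => (a : EReal) - ζ a) a ha).trans hs.le
  rw [EReal.sub_le_iff_le_add (.inr (EReal.coe_ne_top _)) (.inr (EReal.coe_ne_bot _))] at hsub
  exact EReal.sub_le_of_le_add' hsub

end StrongConverse

section StrongDirect

theorem exp_div_le_sq_div_ceil {n : ℕ} {a c R m : ℝ} (hm : Real.exp (-n * c) ≤ m)
    (hR : 1 < ⌈Real.exp (n * R)⌉₊) :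
    Real.exp (-n * (2 * c - a + R)) / 16 ≤
      (m / 2) ^ 2 / (2 * Real.exp (-n * a) * ⌈Real.exp (n * R)⌉₊) := by
  have hone : 1 < Real.exp (n * R) := mod_cast Nat.lt_ceil.mp hR
  have hceil : (⌈Real.exp (n * R)⌉₊ : ℝ) ≤ 2 * Real.exp (n * R) := by
    linarith [Nat.ceil_lt_add_one (Real.exp_pos (n * R)).le]
  have hexp : Real.exp (-n * (2 * c - a + R)) =
      Real.exp (-n * c) ^ 2 / (Real.exp (-n * a) * Real.exp (n * R)) := by
    rw [sq, ← Real.exp_add, ← Real.exp_add, ← Real.exp_sub]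
    congr 1
    ring
  calc _ = (Real.exp (-n * c) / 2) ^ 2 / (2 * Real.exp (-n * a) * (2 * Real.exp (n * R))) := by
        rw [hexp]
        ring
    _ ≤ _ := by gcongr

variable {ι κ : ℕ → Type} {Φ : ∀ n, Sys (ι n × κ n)} {ζ : ℝ → EReal}

theorem exists_dflec_seq {x : ℕ → ℝ} (hx : ∀ n, 0 < x n) {S : ℕ → Set ℝ}
    (hS : ∀ n, S n ⊆ Set.Iic (x n)) (t : ℕ → ℝ) {L : ℕ → ℕ} (hL : ∀ n, 0 < L n) :
    ∃ D : ∀ n, DFLEC (ι n) (κ n), ∀ n, (D n).size = L n ∧ (0 ≤ t n →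
      ENNReal.ofReal (t n) < specMass (reduced (Φ n)) (S n) →
      ENNReal.ofReal (t n) ≤ (D n).fidelity (Φ n) ∨
        1 < L n ∧ ENNReal.ofReal (t n ^ 2 / (2 * x n * L n)) ≤ (D n).fidelity (Φ n)) := by
  have hex : ∀ n, ∃ D : DFLEC (ι n) (κ n), D.size = L n ∧ (0 ≤ t n →
      ENNReal.ofReal (t n) < specMass (reduced (Φ n)) (S n) →
      ENNReal.ofReal (t n) ≤ D.fidelity (Φ n) ∨
        1 < L n ∧ ENNReal.ofReal (t n ^ 2 / (2 * x n * L n)) ≤ D.fidelity (Φ n)) := fun n => by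
    by_cases h : 0 ≤ t n ∧ ENNReal.ofReal (t n) < specMass (reduced (Φ n)) (S n)
    · obtain ⟨D, hD, hfid⟩ := exists_dflec_of_lt_specMass (hx n) h.1 (hS n) h.2 (hL n)
      exact ⟨D, hD, fun _ _ => hfid⟩
    · obtain ⟨I, hI⟩ := exists_pflec_size (Φ n) (hL n)
      exact ⟨I.toDFLEC, hI, fun ht hlt => absurd ⟨ht, hlt⟩ h⟩
  choose D hD using hex
  exact ⟨D, hD⟩

theorem IsZeta.mono (hζ : IsZeta Φ ζ) : Monotone ζ := fun a b hab => by
  refine le_of_tendsto_of_tendsto' (hζ a) (hζ b) fun n =>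
    expo_anti n (specMass_mono _ (Set.Iio_subset_Iio (Real.exp_le_exp.mpr ?_)))
  rw [neg_mul, neg_mul, neg_le_neg_iff]
  gcongr

theorem IsZeta.eventually_exp_le (hζ : IsZeta Φ ζ) {a c : ℝ} (h : ζ a < c) :
    ∀ᶠ n : ℕ in atTop, Real.exp (-n * c) ≤
      (specMass (reduced (Φ n)) (Set.Iio (Real.exp (-n * a)))).toReal := by
  filter_upwards [(hζ a).eventually_lt_const h, eventually_gt_atTop 0] with n hn hn0
  exact (ENNReal.ofReal_le_iff_le_toReal (specMass_ne_top (Φ n) _)).mp ((expo_le_iff hn0).mp hn.le)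

theorem ofReal_half_toReal_specMass_lt {α β : Type} (Φ : Sys (α × β)) {S : Set ℝ}
    (h : 0 < (specMass (reduced Φ) S).toReal) :
    ENNReal.ofReal ((specMass (reduced Φ) S).toReal / 2) < specMass (reduced Φ) S := by
  rw [ENNReal.ofReal_lt_iff_lt_toReal (half_pos h).le (specMass_ne_top Φ _)]
  exact half_lt_self h

theorem le_BePStar (hζ : IsZeta Φ ζ) {a r : ℝ} (h : ζ a ≤ r) :
    (a : EReal) - ζ a ≤ BePStar Φ r := by
  refine EReal.ge_of_forall_gt_iff_ge.mp fun R hR => ?_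
  have hζR : ζ a < (a - R : ℝ) := by
    rw [EReal.coe_sub, EReal.lt_sub_iff_add_lt (.inl (EReal.coe_ne_bot _))
      (.inl (EReal.coe_ne_top _)), add_comm]
    exact EReal.add_lt_of_lt_sub hR
  set m : ℕ → ℝ := fun n => (specMass (reduced (Φ n)) (Set.Iio (Real.exp (-n * a)))).toReal
  obtain ⟨I, hI⟩ := exists_pflec_seq (Φ := Φ) (fun n : ℕ => Real.exp_pos (-n * a))
    (fun n => Set.Iio_subset_Iic_self) fun n => m n / 2
  replace hI (n : ℕ) (hm : 0 < m n) := hI n (half_pos hm).le (ofReal_half_toReal_specMass_lt _ hm)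
  refine le_iSup₂_of_le I (limsup_expo_le_iff.mpr fun r' hr' => ?_)
    (le_rate_of_const_mul (fun n => (I n).target_spec.1) (C := 1 / 4) (by norm_num)
      fun R' hR' => ?_)
  · obtain ⟨c, hrc, hcr'⟩ := exists_between hr'
    filter_upwards [hζ.eventually_exp_le (h.trans_lt (EReal.coe_lt_coe_iff.mpr hrc)),
      eventually_const_mul_exp_le 2 hcr'] with n hm hexp
    exact (ENNReal.ofReal_le_ofReal (by linarith)).trans (hI n ((Real.exp_pos _).trans_le hm)).2
  · filter_upwards [hζ.eventually_exp_le hζR] with n hm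
    calc 1 / 4 * Real.exp (n * R') ≤ 1 / 4 * Real.exp (n * R) := by gcongr
      _ = Real.exp (-n * (a - R)) / 2 / (2 * Real.exp (-n * a)) := by
          rw [show -(n : ℝ) * (a - R) = n * R + -n * a by ring, Real.exp_add]
          field_simp
          norm_num
      _ ≤ m n / 2 / (2 * Real.exp (-n * a)) := by gcongr
      _ ≤ _ := (hI n ((Real.exp_pos _).trans_le hm)).1

theorem le_BeDStar_of_zeta_le (hζ : IsZeta Φ ζ) {a z r R : ℝ} (hz : ζ a ≤ z) (hzr : z ≤ r)
    (hR : 2 * z - a + R ≤ r) : (R : EReal) ≤ BeDStar Φ r := by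
  set m : ℕ → ℝ := fun n => (specMass (reduced (Φ n)) (Set.Iio (Real.exp (-n * a)))).toReal
  obtain ⟨D, hDL⟩ := exists_dflec_seq (Φ := Φ) (fun n : ℕ => Real.exp_pos (-n * a))
    (fun n => Set.Iio_subset_Iic_self) (fun n => m n / 2) (L := fun n => ⌈Real.exp (n * R)⌉₊)
    fun n => Nat.ceil_pos.mpr (Real.exp_pos _)
  refine le_iSup₂_of_le D (limsup_expo_le_iff.mpr fun r' hr' => ?_)
    (by simpa only [(hDL _).1] using le_rate_ceil_exp R)
  obtain ⟨c, hzc, hcr⟩ : ∃ c, z < c ∧ 2 * (c - z) < r' - r :=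
    ⟨z + (r' - r) / 4, by linarith, by linarith⟩
  filter_upwards [hζ.eventually_exp_le (hz.trans_lt (EReal.coe_lt_coe_iff.mpr hzc)),
    eventually_const_mul_exp_le 2 (a := r') (b := c) (by linarith),
    eventually_const_mul_exp_le 16 (a := r') (b := 2 * c - a + R) (by linarith)]
    with n hm hexp hexp'
  have hm0 : 0 < m n := (Real.exp_pos _).trans_le hm
  rcases (hDL n).2 (half_pos hm0).le (ofReal_half_toReal_specMass_lt _ hm0) with hfid | ⟨hL, hfid⟩
  · exact le_trans (ENNReal.ofReal_le_ofReal (by linarith)) hfid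
  · refine le_trans (ENNReal.ofReal_le_ofReal ?_) hfid
    linarith [exp_div_le_sq_div_ceil (a := a) hm hL]

theorem IsZeta.exists_near_infHalf (hζ : IsZeta Φ ζ) {a η : ℝ} (hη : infHalf ζ a ≤ η)
    {δ : ℝ} (hδ : 0 < δ) :
    ∃ a' : ℝ, ζ a' ≤ (η + a / 2 : ℝ) ∧ ζ a' ≤ (η + δ + a' / 2 : ℝ) := by
  have hnear : ∀ d > 0, ∃ a' ≤ a, ζ a' ≤ (η + d + a' / 2 : ℝ) := fun d hd => by
    have hlt : infHalf ζ a < (η + d : ℝ) :=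
      hη.trans_lt (EReal.coe_lt_coe_iff.mpr (lt_add_of_pos_right η hd))
    simp only [infHalf, iInf_lt_iff] at hlt
    obtain ⟨a', ha', hlt⟩ := hlt
    rw [EReal.sub_lt_iff (.inl (EReal.coe_ne_bot _)) (.inl (EReal.coe_ne_top _))] at hlt
    exact ⟨a', ha', mod_cast hlt.le⟩
  by_cases hfar : ∃ d ∈ Set.Ioc 0 δ, ∃ a' ≤ a - 2 * d, ζ a' ≤ (η + d + a' / 2 : ℝ)
  · obtain ⟨d, hd, a', ha', hζa'⟩ := hfar
    exact ⟨a', hζa'.trans (EReal.coe_le_coe_iff.mpr (by linarith)),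
      hζa'.trans (EReal.coe_le_coe_iff.mpr (by linarith [hd.2]))⟩
  -- If all near-minimizers are close to `a`, monotonicity bounds `ζ (a - 2 * δ)` by their values.
  push Not at hfar
  have hleft : ζ (a - 2 * δ) ≤ (η + a / 2 : ℝ) := by
    refine EReal.le_of_forall_lt_iff_le.mp fun y hy => ?_
    have hd : min (y - (η + a / 2)) δ ∈ Set.Ioc 0 δ :=
      ⟨lt_min (sub_pos.mpr (mod_cast hy)) hδ, min_le_right _ _⟩
    obtain ⟨a', ha', hζa'⟩ := hnear _ hd.1
    have haa' : a - 2 * min (y - (η + a / 2)) δ < a' := by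
      by_contra! hle
      exact (hfar _ hd a' hle).not_ge hζa'
    refine (hζ.mono (by linarith [hd.2])).trans
      (hζa'.trans (EReal.coe_le_coe_iff.mpr ?_))
    linarith [min_le_left (y - (η + a / 2)) δ]
  exact ⟨a - 2 * δ, hleft, hleft.trans_eq (congrArg _ (by ring))⟩

theorem infHalf_le_of_add_le {a b r : ℝ} (h : infHalf ζ a + (b : EReal) ≤ r) :
    infHalf ζ a ≤ (r - b : ℝ) :=
  (EReal.le_sub_iff_add_le (.inl (EReal.coe_ne_bot _)) (.inl (EReal.coe_ne_top _))).mpr h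

theorem sub_infHalf_le_BeDStar (hζ : IsZeta Φ ζ) {a r : ℝ}
    (h : infHalf ζ a + ((a / 2 : ℝ) : EReal) ≤ r) :
    ((a / 2 : ℝ) : EReal) - infHalf ζ a ≤ BeDStar Φ r := by
  refine EReal.ge_of_forall_gt_iff_ge.mp fun R hR => ?_
  obtain ⟨R', hRR', hR'⟩ := EReal.lt_iff_exists_real_btwn.mp hR
  have hη : infHalf ζ a ≤ (min (r - a / 2) (a / 2 - R') : ℝ) := by
    rw [EReal.coe_strictMono.monotone.map_min]
    refine le_min (infHalf_le_of_add_le h) (infHalf_le_of_add_le ?_)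
    rw [add_comm]
    exact (EReal.add_lt_of_lt_sub hR').le
  set η := min (r - a / 2) (a / 2 - R')
  have hηr : η ≤ r - a / 2 := min_le_left _ _
  have hηR' : η ≤ a / 2 - R' := min_le_right _ _
  obtain ⟨a', ha, ha'⟩ := hζ.exists_near_infHalf hη
    (half_pos (sub_pos.mpr (EReal.coe_lt_coe_iff.mp hRR')))
  refine le_BeDStar_of_zeta_le hζ (a := a')
    (z := min (η + a / 2) (η + (R' - R) / 2 + a' / 2)) ?_ ?_ ?_
  · rw [EReal.coe_strictMono.monotone.map_min]
    exact le_min ha ha'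
  · linarith [min_le_left (η + a / 2) (η + (R' - R) / 2 + a' / 2)]
  · linarith [min_le_right (η + a / 2) (η + (R' - R) / 2 + a' / 2)]

theorem iSup_sub_le_iSup_sub_infHalf (ζ : ℝ → EReal) (r : ℝ) :
    (⨆ (a : ℝ) (_ : infHalf ζ a + ((a / 2 : ℝ) : EReal) ≤ r), ((a - r : ℝ) : EReal)) ≤
      ⨆ (a : ℝ) (_ : infHalf ζ a + ((a / 2 : ℝ) : EReal) ≤ r),
        (((a / 2 : ℝ) : EReal) - infHalf ζ a) := by
  refine iSup₂_mono fun a h => ?_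
  calc ((a - r : ℝ) : EReal) = (a / 2 : ℝ) - (r - a / 2 : ℝ) := by
        rw [← EReal.coe_sub]
        congr 1
        ring
    _ ≤ _ := EReal.sub_le_sub le_rfl (infHalf_le_of_add_le h)

end StrongDirect

end EntConc

end

theorem theorem1 {ι κ : ℕ → Type} (Φ : ∀ n, EntConc.Sys (ι n × κ n)) (hΦ : ∀ n, ‖Φ n‖ = 1) :
    (∀ ε : ℝ, 0 ≤ ε → ε ≤ 1 →
      EntConc.BD Φ ε = EntConc.BP Φ ε ∧
      EntConc.BP Φ ε = ⨆ (R : ℝ) (_ : EntConc.K Φ R ≤ ENNReal.ofReal ε), (R : EReal)) ∧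
    (∀ r : ℝ,
      EntConc.BeD Φ r = EntConc.BeP Φ r ∧
      EntConc.BeP Φ r = ⨆ (R : ℝ) (_ : (r : EReal) ≤ EntConc.zetaC Φ R), (R : EReal)) ∧
    (∀ ζ : ℝ → EReal, EntConc.IsZeta Φ ζ → (∃ a : ℝ, ζ a ≤ EntConc.zetaC Φ a) →
      ∀ r : ℝ,
        EntConc.BeDStar Φ r =
          (⨆ (a : ℝ) (_ : EntConc.infHalf ζ a + ((a / 2 : ℝ) : EReal) ≤ r),
            ((a - r : ℝ) : EReal)) ∧
        EntConc.BeDStar Φ r =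
          (⨆ (a : ℝ) (_ : EntConc.infHalf ζ a + ((a / 2 : ℝ) : EReal) ≤ r),
            (((a / 2 : ℝ) : EReal) - EntConc.infHalf ζ a)) ∧
        EntConc.BePStar Φ r = ⨆ (a : ℝ) (_ : ζ a ≤ r), ((a : EReal) - ζ a)) := by
  refine ⟨fun ε h0 h1 => ?_, fun r => ?_, fun ζ hζ _ r => ?_⟩
  · have hP : (⨆ (R : ℝ) (_ : EntConc.K Φ R ≤ ENNReal.ofReal ε), (R : EReal)) ≤
        EntConc.BP Φ ε := iSup₂_le fun R hR => EntConc.le_BP hΦ h0 h1 hR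
    have hPD := EntConc.BP_le_BD hΦ h0
    have hD := EntConc.BD_le hΦ h0
    exact ⟨(hD.trans hP).antisymm hPD, (hPD.trans hD).antisymm hP⟩
  · have hP : (⨆ (R : ℝ) (_ : (r : EReal) ≤ EntConc.zetaC Φ R), (R : EReal)) ≤
        EntConc.BeP Φ r := iSup₂_le fun R hR => EntConc.le_BeP hΦ hR
    have hPD := EntConc.BeP_le_BeD hΦ r
    have hD := EntConc.BeD_le hΦ r
    exact ⟨(hD.trans hP).antisymm hPD, (hPD.trans hD).antisymm hP⟩
  · have h12 := EntConc.iSup_sub_le_iSup_sub_infHalf ζ r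
    have hD : (⨆ (a : ℝ) (_ : EntConc.infHalf ζ a + ((a / 2 : ℝ) : EReal) ≤ r),
        (((a / 2 : ℝ) : EReal) - EntConc.infHalf ζ a)) ≤ EntConc.BeDStar Φ r :=
      iSup₂_le fun a h => EntConc.sub_infHalf_le_BeDStar hζ h
    have hle := EntConc.BeDStar_le hζ hΦ r
    exact ⟨hle.antisymm (h12.trans hD), (hle.trans h12).antisymm hD,
      (EntConc.BePStar_le hζ hΦ r).antisymm (iSup₂_le fun a h => EntConc.le_BePStar hζ h)⟩
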